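/- \textbf{Setting.} Let $\mathcal M\subset\mathbb R^{2\nu}$ be open and connected, let $S^{+},S^{-}\subset\mathcal M$ be relatively closed, and let $T:\mathcal M\setminus S^{+}\to\mathcal M\setminus S^{-}$ be a $C^1$ diffeomorphism; $T^n$ ($n\in\mathbb Z$) is regarded as a partially defined map, and $T^iS^{-}$ is the set of points $T^iw$ with $w\in S^-$ in the domain of $T^i$. Let $\mathcal C$ be a field of closed cones $\mathcal C(z)\subset\mathbb R^{2\nu}$, $z\in\mathcal M$ (closed sets containing $0$ and invariant under multiplication by real numbers). For $z$ in the domain of $T^{-n}$ put $\mathcal C_n(z)=DT^n_{T^{-n}z}\,\mathcal C(T^{-n}z)$; for $z\in S^{-}$ let $\mathcal C_1(z)$ be the set of all limits of vectors $v_k\in\mathcal C_1(w_k)$ with $w_k\in\mathcal M\setminus S^{-}$, $w_k\to z$. An unstable curve is a $C^1$ curve $\gamma:[0,1]\to\mathcal M$ with $\gamma'(t)\in\mathcal C_1(\gamma(t))$ for all $t$; $d^u(x,y)$ is the infimum of the lengths of the unstable curves joining $x$ and $y$ ($\infty$ if there are none), $d^u(z,A)=\inf_{a\in A}d^u(z,a)$,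 and $A_{[\varepsilon]}=\{z\in\mathcal M: d^u(z,A)\le\varepsilon\}$. A compact set is regular if it is a finite union of pieces of $C^1$ codimension-one submanifolds, each piece being the closure of its interior in its submanifold, the pieces overlapping at most on their boundaries, and the boundary of each piece being a finite union of compact subsets of codimension-two submanifolds. A set $A$ is regular near $z$ if $A\cap V$ is regular for some neighbourhood $V$ of $z$. \textbf{Assumptions.} (1) $\partial\mathcal M$ is regular near every point of $\mathbb R^{2\nu}$; $\mathcal M$ carries a $C^1$ symplectic form $\omega$, whose symplectic volume is denoted by $\mu$ ($\mu(\mathcal M)=\infty$ is allowed). (2) $T$ preserves $\omega$ and is recurrent: for every measurable $A\subset\mathcal M$, $\mu$-almost every point of $A$ returns to $A$. (3) $\mathcal C$ is continuous on $\mathcal M\setminus S^{+}$, $DT_z\mathcal C(z)\subset\mathcal C(Tz)$ for all $z\in\mathcal M\setminus S^+$, and for $\mu$-a.e. $z$ there is $n\ge1$ with $DT^n_z\mathcal C(z)\subset\operatorname{int}\mathcal C(T^nz)\cup\{0\}$. (4) For all $n$ the sets $\bigcup_{i<n}T^{-i}S^{+}$ and $\bigcup_{i<n}T^{i}S^{-}$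 are regular near every point of $\mathcal M$. (5) There is a finite measure $\pi$ on $S^{-}$, absolutely continuous with respect to the hypersurface measure induced by $\mu$ on $S^{-}$, such that $\limsup_{\varepsilon\to0^+}\mu(A_{[\varepsilon]})/\varepsilon\le\pi(A)$ for every relatively closed $A\subset S^{-}$. (6) At every point $z$ near which $S^{+}$ (respectively $S^{-}$) is a codimension-one submanifold, the $\omega$-orthogonal complement of its tangent space is contained in the closure of $\mathbb R^{2\nu}\setminus\mathcal C(z)$ (respectively in $\mathcal C(z)$). (7) Every $z_0\in\mathcal M$ has a neighbourhood $U_0$, an $\varepsilon_0>0$ and a $K>0$ such that $|DT^n_wv|\ge K|v|$ whenever $w\in S^{-}_{[\varepsilon_0]}$, $n>0$, $T^nw$ is defined and lies in $U_0$, and $v\in\mathcal C_1(w)$. (8) There are norms $\|v\|_z$ for the cone vectors $v\in\mathcal C(z)$, depending continuously on $(z,v)$ and locally equivalent to the Euclidean norm $|\cdot|$, and numbers $\kappa(z)>1$, with $\|DT_zv\|_{Tz}\ge\kappa(z)\|v\|_z$ for all $z\in\mathcal M\setminus S^{+}$ and $v\in\mathcal C(z)$, where $\kappa$ is bounded away from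 $1$ near each point of $\mathcal M$; and for $\pi$-a.e. $z\in S^{-}$ all $T^n$, $n\ge0$, are defined at $z$ and $$\lim_{n\to+\infty}\ \inf_{0\ne v\in\mathcal C_1(z)}\frac{\|DT^n_zv\|_{T^nz}}{\|v\|_z}=+\infty .$$ A local unstable manifold at $z$ is an open embedded $C^1$ disk $W\ni z$ such that every $w\in W$ has an infinite backward orbit with $|T^{-n}w-T^{-n}z|\to0$ as $n\to\infty$, and the tangent space of $W$ at $w$ is contained in $\bigcap_n\mathcal C_n(w)$ and has the maximal dimension of a subspace there. Write $\partial W=\overline W\setminus W$. We say that $W$ has radius less than $\delta$ because it is cut by a set $B$ if some $C^1$ curve of length less than $\delta$ starts at $z$, lies in $W$ except for its endpoint, and ends at a point of $\partial W\cap B$. \textbf{Lemma (tail bound).} Under these assumptions, for every $z_0\in\mathcal M$ there are a neighbourhood $U$ of $z_0$ and a $\delta_0>0$ such that for every $\eta>0$ there is $M\in\mathbb N$ with $$\mu\Bigl(\Bigl\{z\in U:\ \text{some local unstable manifold at } z \text{ has radius}<\delta\text{ because it is cut by }\bigcup_{i=M+1}^{\infty}T^iS^{-}\Bigr\}\Bigr)\le\eta\,\delta\qquad\text{for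 all }0<\delta\le\delta_0 ,$$ where $\mu$ of a set is its outer measure. -/

import Mathlib

open Set Filter Topology MeasureTheory
open scoped ENNReal

/-! ### Regular sets in a Euclidean space -/

/-- `N` is an (embedded, `C¹`) submanifold of codimension `k`: locally the zero set of a
submersion with values in `ℝᵏ`. -/
def IsSubmanifoldOfCodim {E : Type*} [NormedAddCommGroup E] [NormedSpace ℝ E]
    (k : ℕ) (N : Set E) : Prop :=
  ∀ x ∈ N, ∃ U : Set E, IsOpen U ∧ x ∈ U ∧ ∃ f : E → (Fin k → ℝ),
    ContDiffOn ℝ 1 f U ∧ (∀ y ∈ U, Function.Surjective (fderiv ℝ f y)) ∧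
    N ∩ U = {y ∈ U | f y = 0}

/-- The interior of `P` in the topology of `N`. -/
def relInterior {E : Type*} [TopologicalSpace E] (N P : Set E) : Set E :=
  {x ∈ P | ∃ U ∈ 𝓝 x, N ∩ U ⊆ P}

/-- A compact set that is a finite union of pieces `P i` of codimension-one submanifolds `N i`,
where (a) `P i` is the closure of its interior, in the topology of `N i`; (b) different pieces
overlap at most on their boundaries; (c) the boundary of each piece is a finite union of compact
subsets of codimension-two submanifolds.  (As `P i` is closed in `N i`, its boundary in `N i` is
`P i \ relInterior (N i) (P i)`.) -/
def IsRegularSet {E : Type*} [NormedAddCommGroup E] [NormedSpace ℝ E] (A : Set E) : Prop :=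
  IsCompact A ∧ ∃ (n : ℕ) (N P : Fin n → Set E),
    A = ⋃ i, P i ∧
    (∀ i, IsSubmanifoldOfCodim 1 (N i) ∧ P i ⊆ N i ∧
      P i = N i ∩ closure (relInterior (N i) (P i))) ∧
    (∀ i j, i ≠ j → P i ∩ P j ⊆
      (P i \ relInterior (N i) (P i)) ∩ (P j \ relInterior (N j) (P j))) ∧
    (∀ i, ∃ (m : ℕ) (Q B : Fin m → Set E),
      (∀ l, IsSubmanifoldOfCodim 2 (Q l) ∧ B l ⊆ Q l ∧ IsCompact (B l)) ∧
      P i \ relInterior (N i) (P i) = ⋃ l, B l)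

/-- `A` is regular near every point of `O`. -/
def IsLocallyRegularOn {E : Type*} [NormedAddCommGroup E] [NormedSpace ℝ E]
    (A O : Set E) : Prop :=
  ∀ z ∈ O, ∃ U ∈ 𝓝 z, IsRegularSet (A ∩ U)

/-! ### Curves -/

/-- The length of a `C¹` curve parametrized by `[0, 1]`. -/
noncomputable def curveLength {E : Type*} [NormedAddCommGroup E] [NormedSpace ℝ E]
    (γ : ℝ → E) : ℝ≥0∞ :=
  ∫⁻ t in Icc (0 : ℝ) 1, ‖derivWithin γ (Icc (0 : ℝ) 1) t‖ₑ

/-! ### The dynamical system -/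

/-- The Euclidean space `ℝ^{2ν}`. -/
abbrev Sp (ν : ℕ) : Type := EuclideanSpace ℝ (Fin (2 * ν))

/-- The data of a symplectic map with singularities, together with a field of (unstable) cones.
The conditions on these data are the predicates that follow. -/
structure SingularSystem (ν : ℕ) where
  /-- the phase space -/
  M : Set (Sp ν)
  /-- the singularity set of the map -/
  Splus : Set (Sp ν)
  /-- the singularity set of the inverse map -/
  Sminus : Set (Sp ν)
  /-- the map, defined on `T.source`, with its inverse, defined on `T.target` -/
  T : OpenPartialHomeomorph (Sp ν) (Sp ν)
  /-- the symplectic form -/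
  ω : Sp ν → (Sp ν) [⋀^Fin 2]→L[ℝ] ℝ
  /-- the cone field -/
  cone : Sp ν → Set (Sp ν)

namespace SingularSystem

variable {ν : ℕ}

/-- The density of the symplectic volume with respect to Lebesgue measure: the absolute value of
the Pfaffian of the matrix of `ω`, which is the square root of its determinant. -/
noncomputable def volumeDensity (S : SingularSystem ν) (z : Sp ν) : ℝ :=
  Real.sqrt |(Matrix.of fun i j : Fin (2 * ν) =>
    S.ω z ![EuclideanSpace.single i 1, EuclideanSpace.single j 1]).det|

/-- The symplectic volume on the phase space. -/
noncomputable def μ (S : SingularSystem ν) : Measure (Sp ν) :=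
  (volume.restrict S.M).withDensity fun z => ENNReal.ofReal (S.volumeDensity z)

/-- The domain of `Tⁿ`. -/
def dom (S : SingularSystem ν) (n : ℕ) : Set (Sp ν) :=
  {z ∈ S.M | ∀ j < n, S.T^[j] z ∈ S.T.source}

/-- The domain of `T⁻ⁿ`. -/
def bwdDom (S : SingularSystem ν) (n : ℕ) : Set (Sp ν) :=
  {z ∈ S.M | ∀ j < n, S.T.symm^[j] z ∈ S.T.target}

/-- `Tⁿ S⁻`, the image of the part of `S⁻` where `Tⁿ` is defined. -/
def imageSminus (S : SingularSystem ν) (n : ℕ) : Set (Sp ν) :=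
  S.T^[n] '' (S.Sminus ∩ S.dom n)

/-- `T⁻ⁿ S⁺`. -/
def preimageSplus (S : SingularSystem ν) (n : ℕ) : Set (Sp ν) :=
  S.T.symm^[n] '' (S.Splus ∩ S.bwdDom n)

/-- The differential of `Tⁿ`. -/
noncomputable def D (S : SingularSystem ν) (n : ℕ) (z : Sp ν) : Sp ν →L[ℝ] Sp ν :=
  fderiv ℝ (S.T^[n]) z

/-- The `n`-th nested cone at a point `z` where `T⁻ⁿ` is defined. -/
def nestedCone (S : SingularSystem ν) (n : ℕ) (z : Sp ν) : Set (Sp ν) :=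
  S.D n (S.T.symm^[n] z) '' S.cone (S.T.symm^[n] z)

/-- The first nested cone.  At a point of `S⁻`, where `T⁻¹` is not defined, it consists of all
limits of vectors of the first nested cones at points outside `S⁻` that tend to the point. -/
def coneOne (S : SingularSystem ν) (z : Sp ν) : Set (Sp ν) :=
  {v | (z ∉ S.Sminus ∧ v ∈ S.nestedCone 1 z) ∨
    (z ∈ S.Sminus ∧
      (z, v) ∈ closure {p : Sp ν × Sp ν | p.1 ∈ S.T.target ∧ p.2 ∈ S.nestedCone 1 p.1})}

/-- A `C¹` curve from `x` to `y` in the phase space, with tangent vectors in the first nested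
cones. -/
structure IsUnstableCurve (S : SingularSystem ν) (γ : ℝ → Sp ν) (x y : Sp ν) : Prop where
  contDiffOn : ContDiffOn ℝ 1 γ (Icc 0 1)
  start : γ 0 = x
  finish : γ 1 = y
  mem : ∀ t ∈ Icc (0 : ℝ) 1, γ t ∈ S.M
  tangent : ∀ t ∈ Icc (0 : ℝ) 1, derivWithin γ (Icc 0 1) t ∈ S.coneOne (γ t)

/-- The unstable distance of two points, `∞` if no unstable curve joins them. -/
noncomputable def unstableDist (S : SingularSystem ν) (x y : Sp ν) : ℝ≥0∞ :=
  ⨅ (γ : ℝ → Sp ν) (_ : S.IsUnstableCurve γ x y), curveLength γ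

/-- The closed tubular neighbourhood of `A`, of radius `ε`, in the unstable distance. -/
def tube (S : SingularSystem ν) (A : Set (Sp ν)) (ε : ℝ) : Set (Sp ν) :=
  {z ∈ S.M | (⨅ a ∈ A, S.unstableDist z a) ≤ ENNReal.ofReal ε}

/-! ### The conditions -/

/-- Phase space: open, connected, with locally regular boundary and a symplectic form. -/
structure PhaseSpaceCondition (S : SingularSystem ν) : Prop where
  isOpen : IsOpen S.M
  isConnected : IsConnected S.M
  boundary : IsLocallyRegularOn (frontier S.M) univ
  form_contDiffOn : ContDiffOn ℝ 1 S.ω S.M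
  form_closed : ∀ z ∈ S.M, extDeriv S.ω z = 0
  form_nondegenerate : ∀ z ∈ S.M, ∀ v, v ≠ 0 → ∃ u, S.ω z ![v, u] ≠ 0

/-- Map: an invertible, recurrent, `C¹` map of `M \ S⁺` onto `M \ S⁻` that preserves the
symplectic form. -/
structure MapCondition (S : SingularSystem ν) : Prop where
  Splus_subset : S.Splus ⊆ S.M
  Sminus_subset : S.Sminus ⊆ S.M
  source_eq : S.T.source = S.M \ S.Splus
  target_eq : S.T.target = S.M \ S.Sminus
  contDiffOn : ContDiffOn ℝ 1 S.T S.T.source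
  contDiffOn_symm : ContDiffOn ℝ 1 S.T.symm S.T.target
  symplectic : ∀ z ∈ S.T.source, ∀ u v,
    S.ω (S.T z) ![S.D 1 z u, S.D 1 z v] = S.ω z ![u, v]
  recurrent : ∀ A ⊆ S.M, MeasurableSet A →
    ∀ᵐ z ∂S.μ, z ∈ A → ∃ n, 0 < n ∧ z ∈ S.dom n ∧ S.T^[n] z ∈ A

/-- Cone bundle: closed cones, invariant and eventually strictly invariant under the map, that
vary continuously where the map is defined. -/
structure ConeCondition (S : SingularSystem ν) : Prop where
  isClosed : ∀ z ∈ S.M, IsClosed (S.cone z)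
  zero_mem : ∀ z ∈ S.M, (0 : Sp ν) ∈ S.cone z
  smul_mem : ∀ z ∈ S.M, ∀ v ∈ S.cone z, ∀ t : ℝ, t • v ∈ S.cone z
  continuous : ∀ z ∈ S.T.source, ∀ ε > 0, ∀ᶠ w in 𝓝 z,
    (∀ v ∈ S.cone w, ‖v‖ = 1 → ∃ u ∈ S.cone z, ‖u - v‖ < ε) ∧
    (∀ v ∈ S.cone z, ‖v‖ = 1 → ∃ u ∈ S.cone w, ‖u - v‖ < ε)
  invariant : ∀ z ∈ S.T.source, S.D 1 z '' S.cone z ⊆ S.cone (S.T z)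
  eventually_strict : ∀ᵐ z ∂S.μ, ∃ n, 0 < n ∧ z ∈ S.dom n ∧
    S.D n z '' S.cone z ⊆ interior (S.cone (S.T^[n] z)) ∪ {0}

/-- Local regularity of the singularity sets of all powers of the map. -/
def RegularityCondition (S : SingularSystem ν) : Prop :=
  ∀ n : ℕ, IsLocallyRegularOn (⋃ i < n, S.preimageSplus i) S.M ∧
    IsLocallyRegularOn (⋃ i < n, S.imageSminus i) S.M

/-- The measure that `μ` and the distance induce on `S⁻`. -/
noncomputable def surfaceMeasure (S : SingularSystem ν) : Measure (Sp ν) :=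
  ((Measure.hausdorffMeasure (2 * (ν : ℝ) - 1)).restrict S.Sminus).withDensity
    fun z => ENNReal.ofReal (S.volumeDensity z)

/-- Measure of tubular neighbourhoods: `π` is a finite measure on `S⁻`, absolutely continuous with
respect to the induced measure, and `limsup μ(A_[ε]) / ε ≤ π(A)` as `ε → 0⁺`, for every relatively
closed subset `A = S⁻ ∩ F` of `S⁻`. -/
structure TubeCondition (S : SingularSystem ν) (π : Measure (Sp ν)) : Prop where
  finite : π univ < ∞
  supported : π S.Sminusᶜ = 0
  absolutelyContinuous : π ≪ S.surfaceMeasure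
  tube_le : ∀ F : Set (Sp ν), IsClosed F → ∀ h : ℝ, 0 < h → ∀ᶠ ε : ℝ in 𝓝[>] 0,
    S.μ (S.tube (S.Sminus ∩ F) ε) ≤ (π (S.Sminus ∩ F) + ENNReal.ofReal h) * ENNReal.ofReal ε

/-- `H` is the tangent space at `z` of a set `A` that is a codimension-one submanifold near `z`. -/
def IsTangentHyperplane (A : Set (Sp ν)) (z : Sp ν) (H : Submodule ℝ (Sp ν)) : Prop :=
  ∃ U : Set (Sp ν), IsOpen U ∧ z ∈ U ∧ ∃ f : Sp ν → ℝ, ContDiffOn ℝ 1 f U ∧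
    (∀ y ∈ U, fderiv ℝ f y ≠ 0) ∧ A ∩ U = {y ∈ U | f y = 0} ∧
    H = LinearMap.ker (fderiv ℝ f z : Sp ν →ₗ[ℝ] ℝ)

/-- The skew-orthogonal complement of `H` with respect to the symplectic form at `z`. -/
def skewComplement (S : SingularSystem ν) (z : Sp ν) (H : Submodule ℝ (Sp ν)) : Set (Sp ν) :=
  {v | ∀ u ∈ H, S.ω z ![v, u] = 0}

/-- Proper alignment: the characteristic lines of `S⁺` lie in the complementary cones, those of
`S⁻` in the cones. -/
def AlignmentCondition (S : SingularSystem ν) : Prop :=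
  (∀ z ∈ S.Splus, ∀ H, IsTangentHyperplane S.Splus z H →
    S.skewComplement z H ⊆ closure (S.cone z)ᶜ) ∧
  (∀ z ∈ S.Sminus, ∀ H, IsTangentHyperplane S.Sminus z H → S.skewComplement z H ⊆ S.cone z)

/-- Non-contraction around the singularity set. -/
def NonContractionCondition (S : SingularSystem ν) : Prop :=
  ∀ z₀ ∈ S.M, ∃ U₀ ∈ 𝓝 z₀, ∃ ε₀ > 0, ∃ K > 0,
    ∀ w ∈ S.tube S.Sminus ε₀, ∀ n > 0, w ∈ S.dom n → S.T^[n] w ∈ U₀ →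
      ∀ v ∈ S.coneOne w, K * ‖v‖ ≤ ‖S.D n w v‖

/-- `N z v` is a (continuous) norm for cone vectors `v ∈ cone z`, locally equivalent to the
Euclidean norm, that is increased by the map by factors `κ z > 1`, and there is no point of the
phase space near which the factors are not bounded away from `1`. -/
structure IsIncreasingNorm (S : SingularSystem ν) (N : Sp ν → Sp ν → ℝ) : Prop where
  smul : ∀ z ∈ S.M, ∀ v ∈ S.cone z, ∀ t : ℝ, N z (t • v) = |t| * N z v
  add_le : ∀ z ∈ S.M, ∀ u ∈ S.cone z, ∀ v ∈ S.cone z, u + v ∈ S.cone z →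
    N z (u + v) ≤ N z u + N z v
  continuousOn : ContinuousOn (fun p : Sp ν × Sp ν => N p.1 p.2)
    {p | p.1 ∈ S.M ∧ p.2 ∈ S.cone p.1}
  locally_equivalent : ∀ z ∈ S.M, ∃ a > 0, ∃ b > 0, ∀ᶠ w in 𝓝 z,
    ∀ v ∈ S.cone w, a * ‖v‖ ≤ N w v ∧ N w v ≤ b * ‖v‖
  increasing : ∃ κ : Sp ν → ℝ,
    (∀ z ∈ S.T.source, 1 < κ z ∧ ∀ v ∈ S.cone z, κ z * N z v ≤ N (S.T z) (S.D 1 z v)) ∧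
    {z ∈ S.M | ∃ x : ℕ → Sp ν, (∀ n, x n ∈ S.T.source) ∧ Tendsto x atTop (𝓝 z) ∧
      Tendsto (fun n => κ (x n)) atTop (𝓝 1)} = ∅

/-- Sinai–Chernov Ansatz for the norm `N`: at almost every point `z` of `S⁻` all powers of the map
are defined, and the infimum of `‖D Tⁿ v‖ / ‖v‖` over `0 ≠ v ∈ coneOne z` tends to `+∞`. -/
def SinaiChernovAnsatz (S : SingularSystem ν) (π : Measure (Sp ν)) (N : Sp ν → Sp ν → ℝ) : Prop :=
  ∀ᵐ z ∂π, z ∈ S.Sminus → (∀ n, z ∈ S.dom n) ∧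
    ∀ R : ℝ, ∀ᶠ n in atTop, ∀ v ∈ S.coneOne z, R * N z v ≤ N (S.T^[n] z) (S.D n z v)

/-! ### Local unstable manifolds -/

/-- `W` is a local unstable manifold at `z`: a `C¹` (open, embedded) disk through `z`, of some
dimension `d`, whose points have infinite backward orbits asymptotic to that of `z`, and whose
tangent spaces lie in the nested cones of all orders and have the maximal dimension there.  Neither
uniqueness nor maximality of `W` is required, so that every choice of a local unstable manifold at
`z`, in particular the one prolonged as far as possible, is among these sets. -/
def IsLocalUnstableManifold (S : SingularSystem ν) (z : Sp ν) (W : Set (Sp ν)) : Prop :=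
  z ∈ W ∧ ∃ (d : ℕ) (φ : EuclideanSpace ℝ (Fin d) → Sp ν),
    ContDiff ℝ 1 φ ∧ IsEmbedding φ ∧ (∀ x, Function.Injective (fderiv ℝ φ x)) ∧ range φ = W ∧
    (∀ w ∈ W, (∀ n, w ∈ S.bwdDom n) ∧
      Tendsto (fun n : ℕ => ‖S.T.symm^[n] w - S.T.symm^[n] z‖) atTop (𝓝 0)) ∧
    (∀ x, (∀ n, range (fderiv ℝ φ x) ⊆ S.nestedCone n (φ x)) ∧
      ∀ V : Submodule ℝ (Sp ν), (∀ n, (V : Set (Sp ν)) ⊆ S.nestedCone n (φ x)) →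
        Module.finrank ℝ V ≤ d)

end SingularSystem

/-- The infimum of the lengths of the `C¹` curves in `W` that join `z` with a point of
`∂W ∩ B`, where `∂W = closure W \ W` is the boundary of the open disk `W`.  For `B = univ` this is
the radius of `W`; that it is smaller than `δ` means that `W` has radius less than `δ` because it
is cut by `B`. -/
noncomputable def radiusCutBy {E : Type*} [NormedAddCommGroup E] [NormedSpace ℝ E]
    (z : E) (W B : Set E) : ℝ≥0∞ :=
  ⨅ (γ : ℝ → E) (_ : ContDiffOn ℝ 1 γ (Icc 0 1) ∧ γ 0 = z ∧ (∀ t ∈ Ico (0 : ℝ) 1, γ t ∈ W) ∧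
    γ 1 ∈ (closure W \ W) ∩ B), curveLength γ

/-! Fix a small ball `U` around `z₀`. If a local unstable manifold at `z ∈ U` is cut by `TⁱS⁻`
within distance `δ`, the cutting curve pulls back under `T⁻ⁱ` to an unstable curve from `w = T⁻ⁱz`
to a point of `S⁻`. Non-contraction bounds the loss of length up to the first visit to `U`, and
every visit gains a factor `κ > 1`. So `w` lies in the tube around `S⁻` of radius `cδκ⁻ᵏ`, where `k`
is the number of visits to `U` before time `i` (`exists_unstableCurve_of_cut`).

For fixed `k`, the sets of points `w` that make their `(k+1)`-st visit at time `i` are disjoint for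
different `i`. As `T` does not increase volume, the measures of all cut points, summed over `i`, are
at most the sum over `k` of the measures of these tubes (`tsum_visitMass_le`,
`measure_le_tsum_visitMass`). By the tube condition this is a geometric series of order `δ`; mere
exponential growth in the number of visits replaces any uniform expansion rate in time.

Two ranges of `δ` remain. For small `δ`, the Ansatz yields a closed set `F` of small measure `π`
outside which all iterates of large order expand by a large factor `R` on balls of a fixed radius.
Tubes around `S⁻ ∩ F` are small because `π F` is, and curves ending elsewhere lie in tubes thinner
by a factor of order `1/R` (`exists_measure_cutSet_le_mul`). For `δ` bounded away from zero, the
series over `i` converges, so its tail is as small as desired (`exists_measure_cutSet_le`). -/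

/-! ### Calculus of iterates and of curves in embedded manifolds. -/

section Calculus

variable {E F : Type*} [NormedAddCommGroup E] [NormedSpace ℝ E]
  [NormedAddCommGroup F] [NormedSpace ℝ F]

/-- The domain of the `n`-th iterate of a partially defined `C¹` map is open, and the iterate is
`C¹` there. -/
lemma isOpen_and_contDiffOn_iterate {M s : Set E} {f : E → E} (hM : IsOpen M) (hs : IsOpen s)
    (hf : ContDiffOn ℝ 1 f s) (n : ℕ) :
    IsOpen {z ∈ M | ∀ j < n, f^[j] z ∈ s} ∧
      ContDiffOn ℝ 1 f^[n] {z ∈ M | ∀ j < n, f^[j] z ∈ s} := by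
  induction n with
  | zero => simpa using ⟨hM, contDiffOn_id⟩
  | succ n ih =>
    have h : {z ∈ M | ∀ j < n + 1, f^[j] z ∈ s} =
        {z ∈ M | ∀ j < n, f^[j] z ∈ s} ∩ f^[n] ⁻¹' s := by
      ext z
      simp only [Nat.lt_succ_iff_lt_or_eq, mem_ofPred_eq, mem_inter_iff, mem_preimage]
      constructor
      · exact fun ⟨h1, h2⟩ => ⟨⟨h1, fun j hj => h2 j (Or.inl hj)⟩, h2 n (Or.inr rfl)⟩
      · rintro ⟨⟨h1, h2⟩, h3⟩
        refine ⟨h1, ?_⟩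
        rintro j (hj | rfl)
        exacts [h2 j hj, h3]
    rw [h, Function.iterate_succ']
    exact ⟨ih.2.continuousOn.isOpen_inter_preimage ih.1 hs,
      hf.comp (ih.2.mono inter_subset_left) fun z hz => hz.2⟩

/-- The tangent vectors of a curve in an embedded, immersed `C¹` manifold are tangent to the
manifold. -/
lemma HasDerivWithinAt.mem_range_fderiv_of_isEmbedding [FiniteDimensional ℝ F]
    [FiniteDimensional ℝ E] {φ : F → E}
    (hφ : ContDiff ℝ 1 φ) (he : IsEmbedding φ) {x : F} (hx : Function.Injective (fderiv ℝ φ x))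
    {γ : ℝ → E} {v : E} {s : Set ℝ} {t : ℝ} (hγ : HasDerivWithinAt γ v s t)
    (hs : UniqueDiffWithinAt ℝ s t) (hts : t ∈ s) (hxt : γ t = φ x)
    (hmem : ∀ u ∈ s, γ u ∈ range φ) : v ∈ range (fderiv ℝ φ x) := by
  have hst : HasStrictFDerivAt φ (fderiv ℝ φ x) x := hφ.contDiffAt.hasStrictFDerivAt one_ne_zero
  -- Composing `φ` with a left inverse `P` of its differential gives a map between spaces of equal
  -- dimension, with derivative the identity at `x`, so that the inverse function theorem applies.
  obtain ⟨P, hP⟩ := LinearMap.exists_leftInverse_of_injective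
    (fderiv ℝ φ x : F →ₗ[ℝ] E) (LinearMap.ker_eq_bot.2 hx)
  have hPid : (LinearMap.toContinuousLinearMap P).comp (fderiv ℝ φ x) =
      ((ContinuousLinearEquiv.refl ℝ F : F ≃L[ℝ] F) : F →L[ℝ] F) := by
    ext y
    exact DFunLike.congr_fun hP y
  have hg : HasStrictFDerivAt (fun y => LinearMap.toContinuousLinearMap P (φ y))
      ((ContinuousLinearEquiv.refl ℝ F : F ≃L[ℝ] F) : F →L[ℝ] F) x := by
    rw [← hPid]
    exact (LinearMap.toContinuousLinearMap P).hasStrictFDerivAt.comp x hst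
  choose! ξ hξ using hmem
  have hξt : ξ t = x := he.injective (by rw [hξ t hts, hxt])
  have hξc : Tendsto ξ (𝓝[s] t) (𝓝 x) := by
    rw [he.toIsInducing.nhds_eq_comap, tendsto_comap_iff, ← hxt]
    refine hγ.continuousWithinAt.tendsto.congr' ?_
    filter_upwards [self_mem_nhdsWithin] with u hu
    exact (hξ u hu).symm
  -- The lift `ξ` of the curve is only known to be continuous, by the embedding; written as a local
  -- inverse of `P ∘ φ` applied to `P ∘ γ` it is differentiable, and the chain rule for `γ = φ ∘ ξ`
  -- concludes.
  have hinv : ξ =ᶠ[𝓝[s] t] fun u =>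
      hg.localInverse _ _ _ (LinearMap.toContinuousLinearMap P (γ u)) := by
    filter_upwards [hξc.eventually hg.eventually_left_inverse, self_mem_nhdsWithin] with u hu hus
    rw [← hξ u hus]
    exact hu.symm
  have hl := hg.to_localInverse.hasFDerivAt
  have h1 : HasDerivWithinAt (fun u => LinearMap.toContinuousLinearMap P (γ u))
      (LinearMap.toContinuousLinearMap P v) s t :=
    (LinearMap.toContinuousLinearMap P).hasFDerivAt.comp_hasDerivWithinAt t hγ
  rw [← hxt] at hl
  have h2 := hl.comp_hasDerivWithinAt t h1
  have h3 := h2.congr_of_eventuallyEq_of_mem hinv hts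
  have hst' : HasFDerivAt φ (fderiv ℝ φ x) (ξ t) := by
    rw [hξt]
    exact hst.hasFDerivAt
  have h4 := hst'.comp_hasDerivWithinAt t h3
  have h5 := (h4.congr (fun u hu => (hξ u hu).symm) (hξ t hts).symm)
  rw [hs.eq_deriv _ hγ h5]
  exact mem_range_self _

end Calculus

/-! ### Orbits and differentials of the partially defined iterates. -/

namespace SingularSystem

variable {ν : ℕ} {S : SingularSystem ν}

lemma isOpen_dom (hphase : S.PhaseSpaceCondition) (hmap : S.MapCondition) (n : ℕ) :
    IsOpen (S.dom n) :=
  (isOpen_and_contDiffOn_iterate hphase.isOpen S.T.open_source hmap.contDiffOn n).1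

lemma contDiffOn_iterate (hphase : S.PhaseSpaceCondition) (hmap : S.MapCondition) (n : ℕ) :
    ContDiffOn ℝ 1 S.T^[n] (S.dom n) :=
  (isOpen_and_contDiffOn_iterate hphase.isOpen S.T.open_source hmap.contDiffOn n).2

lemma isOpen_bwdDom (hphase : S.PhaseSpaceCondition) (hmap : S.MapCondition) (n : ℕ) :
    IsOpen (S.bwdDom n) :=
  (isOpen_and_contDiffOn_iterate hphase.isOpen S.T.open_target hmap.contDiffOn_symm n).1

lemma contDiffOn_symm_iterate (hphase : S.PhaseSpaceCondition) (hmap : S.MapCondition) (n : ℕ) :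
    ContDiffOn ℝ 1 S.T.symm^[n] (S.bwdDom n) :=
  (isOpen_and_contDiffOn_iterate hphase.isOpen S.T.open_target hmap.contDiffOn_symm n).2

lemma dom_anti {m n : ℕ} (h : m ≤ n) : S.dom n ⊆ S.dom m :=
  fun _ hz => ⟨hz.1, fun j hj => hz.2 j (hj.trans_le h)⟩

lemma source_subset (hmap : S.MapCondition) : S.T.source ⊆ S.M := by
  rw [hmap.source_eq]; exact sdiff_subset

lemma target_subset (hmap : S.MapCondition) : S.T.target ⊆ S.M := by
  rw [hmap.target_eq]; exact sdiff_subset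

lemma mem_source_of_mem_dom {n : ℕ} (hn : 0 < n) {z : Sp ν} (hz : z ∈ S.dom n) :
    z ∈ S.T.source := hz.2 0 hn

lemma mem_dom_one (hmap : S.MapCondition) {z : Sp ν} (hz : z ∈ S.T.source) : z ∈ S.dom 1 :=
  ⟨source_subset hmap hz, fun j hj => by
    obtain rfl : j = 0 := by omega
    exact hz⟩

lemma iterate_mem_M (hmap : S.MapCondition) {n : ℕ} {z : Sp ν} (hz : z ∈ S.dom n) :
    S.T^[n] z ∈ S.M := by
  cases n with
  | zero => exact hz.1
  | succ n =>
    rw [Function.iterate_succ_apply']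
    exact target_subset hmap (S.T.map_source (hz.2 n n.lt_succ_self))

lemma iterate_mem_dom (hmap : S.MapCondition) {m n : ℕ} {z : Sp ν} (hz : z ∈ S.dom (m + n)) :
    S.T^[m] z ∈ S.dom n := by
  refine ⟨iterate_mem_M hmap (dom_anti (Nat.le_add_right m n) hz), fun j hj => ?_⟩
  rw [← Function.iterate_add_apply]
  exact hz.2 _ (by omega)

lemma hasFDerivAt_iterate (hphase : S.PhaseSpaceCondition) (hmap : S.MapCondition) {n : ℕ}
    {z : Sp ν} (hz : z ∈ S.dom n) : HasFDerivAt S.T^[n] (S.D n z) z :=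
  (((contDiffOn_iterate hphase hmap n).contDiffAt
    ((isOpen_dom hphase hmap n).mem_nhds hz)).differentiableAt one_ne_zero).hasFDerivAt

lemma D_add (hphase : S.PhaseSpaceCondition) (hmap : S.MapCondition) {m n : ℕ} {z : Sp ν}
    (hz : z ∈ S.dom (m + n)) : S.D (m + n) z = (S.D n (S.T^[m] z)).comp (S.D m z) := by
  have h1 := hasFDerivAt_iterate hphase hmap (dom_anti (Nat.le_add_right m n) hz)
  have h2 := hasFDerivAt_iterate hphase hmap (iterate_mem_dom hmap hz)
  have h3 := h2.comp z h1
  rw [← Function.iterate_add, add_comm n m] at h3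
  exact h3.fderiv

lemma D_zero_apply (z v : Sp ν) : S.D 0 z v = v := by
  simp [D]

lemma D_succ_apply (hphase : S.PhaseSpaceCondition) (hmap : S.MapCondition) {n : ℕ} {z : Sp ν}
    (hz : z ∈ S.dom (n + 1)) (v : Sp ν) :
    S.D (n + 1) z v = S.D 1 (S.T^[n] z) (S.D n z v) := by
  rw [D_add hphase hmap hz]; rfl

/-- Backward orbits, read forward. -/
lemma symm_iterate_mem_dom (hmap : S.MapCondition) {n : ℕ} {z : Sp ν} (hz : z ∈ S.bwdDom n) :
    S.T.symm^[n] z ∈ S.dom n ∧ S.T^[n] (S.T.symm^[n] z) = z := by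
  induction n with
  | zero => exact ⟨⟨hz.1, by simp⟩, rfl⟩
  | succ n ih =>
    have hz' : z ∈ S.bwdDom n := ⟨hz.1, fun j hj => hz.2 j (by omega)⟩
    obtain ⟨h1, h2⟩ := ih hz'
    have ht := hz.2 n n.lt_succ_self
    have hs := S.T.map_target ht
    rw [Function.iterate_succ_apply']
    have hTs : S.T (S.T.symm (S.T.symm^[n] z)) = S.T.symm^[n] z := S.T.right_inv ht
    refine ⟨⟨source_subset hmap hs, fun j hj => ?_⟩, ?_⟩
    · cases j with
      | zero => exact hs
      | succ j =>
        rw [Function.iterate_succ_apply, hTs]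
        exact h1.2 j (by omega)
    · rw [Function.iterate_succ_apply, hTs, h2]

lemma iterate_mem_bwdDom (hmap : S.MapCondition) {n : ℕ} {z : Sp ν} (hz : z ∈ S.dom n) :
    S.T^[n] z ∈ S.bwdDom n ∧ S.T.symm^[n] (S.T^[n] z) = z := by
  induction n with
  | zero => exact ⟨⟨hz.1, by simp⟩, rfl⟩
  | succ n ih =>
    obtain ⟨h1, h2⟩ := ih (dom_anti n.le_succ hz)
    have hs := hz.2 n n.lt_succ_self
    have ht := S.T.map_source hs
    rw [Function.iterate_succ_apply']
    have hTs : S.T.symm (S.T (S.T^[n] z)) = S.T^[n] z := S.T.left_inv hs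
    refine ⟨⟨target_subset hmap ht, fun j hj => ?_⟩, ?_⟩
    · cases j with
      | zero => exact ht
      | succ j =>
        rw [Function.iterate_succ_apply, hTs]
        exact h1.2 j (by omega)
    · rw [Function.iterate_succ_apply, hTs, h2]

end SingularSystem

/-! ### Pulling back curves in local unstable manifolds. -/

namespace SingularSystem

variable {ν : ℕ} {S : SingularSystem ν}

lemma D_injective (hphase : S.PhaseSpaceCondition) (hmap : S.MapCondition) {n : ℕ} {z : Sp ν}
    (hz : z ∈ S.dom n) : Function.Injective (S.D n z) := by
  have h1 := hasFDerivAt_iterate hphase hmap hz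
  have h2 := (((contDiffOn_symm_iterate hphase hmap n).contDiffAt
    ((isOpen_bwdDom hphase hmap n).mem_nhds (iterate_mem_bwdDom hmap hz).1)).differentiableAt
    one_ne_zero).hasFDerivAt
  have h3 := h2.comp z h1
  have h4 : S.T.symm^[n] ∘ S.T^[n] =ᶠ[𝓝 z] id := by
    filter_upwards [(isOpen_dom hphase hmap n).mem_nhds hz] with y hy
    exact (iterate_mem_bwdDom hmap hy).2
  have h5 := h3.unique ((hasFDerivAt_id z).congr_of_eventuallyEq h4)
  intro u v huv
  have := DFunLike.congr_fun h5 u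
  have hvid := DFunLike.congr_fun h5 v
  simp only [ContinuousLinearMap.comp_apply, ContinuousLinearMap.id_apply] at this hvid
  rw [← this, ← hvid, huv]

/-- The derivative of the image of a curve under an iterate of the map. -/
lemma hasDerivWithinAt_iterate_comp (hphase : S.PhaseSpaceCondition) (hmap : S.MapCondition)
    {n : ℕ} {σ : ℝ → Sp ν} (hσ : ContDiffOn ℝ 1 σ (Icc 0 1)) {t : ℝ} (ht : t ∈ Icc (0 : ℝ) 1)
    (hd : σ t ∈ S.dom n) :
    HasDerivWithinAt (fun t => S.T^[n] (σ t)) (S.D n (σ t) (derivWithin σ (Icc 0 1) t))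
      (Icc 0 1) t :=
  (hasFDerivAt_iterate hphase hmap hd).comp_hasDerivWithinAt t
    ((hσ.differentiableOn one_ne_zero) t ht).hasDerivWithinAt

/-- Pulling back a curve in a local unstable manifold that ends in `Tⁱ S⁻` yields an unstable
curve that ends in `S⁻`. -/
lemma IsLocalUnstableManifold.isUnstableCurve (hphase : S.PhaseSpaceCondition)
    (hmap : S.MapCondition) {z a : Sp ν} {W : Set (Sp ν)} (hW : S.IsLocalUnstableManifold z W)
    {γ : ℝ → Sp ν} (hγ : ContDiffOn ℝ 1 γ (Icc 0 1)) (h0 : γ 0 = z)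
    (hγW : ∀ t ∈ Ico (0 : ℝ) 1, γ t ∈ W) {i : ℕ} (ha : a ∈ S.Sminus) (hai : a ∈ S.dom i)
    (h1 : γ 1 = S.T^[i] a) :
    S.IsUnstableCurve (fun t => S.T.symm^[i] (γ t)) (S.T.symm^[i] z) a ∧
      ∀ t ∈ Icc (0 : ℝ) 1, S.T.symm^[i] (γ t) ∈ S.dom i ∧
        S.T^[i] (S.T.symm^[i] (γ t)) = γ t := by
  obtain ⟨-, d, φ, hφ, he, hinj, rfl, hbwd, hcone⟩ := hW
  have hdom : ∀ t ∈ Icc (0 : ℝ) 1, γ t ∈ S.bwdDom i := by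
    intro t ht
    rcases ht.2.eq_or_lt with rfl | h
    · rw [h1]; exact (iterate_mem_bwdDom hmap hai).1
    · exact (hbwd _ (hγW t ⟨ht.1, h⟩)).1 i
  have hfwd := fun t ht => symm_iterate_mem_dom hmap (hdom t ht)
  have hσ : ContDiffOn ℝ 1 (fun t => S.T.symm^[i] (γ t)) (Icc 0 1) :=
    (contDiffOn_symm_iterate hphase hmap i).comp hγ hdom
  have hσ1 : S.T.symm^[i] (γ 1) = a := by
    rw [h1]; exact (iterate_mem_bwdDom hmap hai).2
  have htan : ∀ t ∈ Ico (0 : ℝ) 1, S.T.symm^[i] (γ t) ∈ S.T.target ∧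
      derivWithin (fun t => S.T.symm^[i] (γ t)) (Icc 0 1) t
        ∈ S.nestedCone 1 (S.T.symm^[i] (γ t)) := by
    intro t ht
    have ht' := Ico_subset_Icc_self ht
    have hb := (hbwd _ (hγW t ht)).1 (i + 1)
    have htgt : S.T.symm^[i] (γ t) ∈ S.T.target := hb.2 i i.lt_succ_self
    refine ⟨htgt, ?_⟩
    obtain ⟨x, hx⟩ := hγW t ht
    have hg := ((hγ.differentiableOn one_ne_zero) t ht').hasDerivWithinAt
    -- The endpoint of `γ` is outside `W`, so tangency is tested within the half-open interval.
    have hmem : derivWithin γ (Icc 0 1) t ∈ range (fderiv ℝ φ x) :=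
      (hg.mono Ico_subset_Icc_self).mem_range_fderiv_of_isEmbedding hφ he (hinj x)
        (uniqueDiffOn_Ico 0 1 t ht) ht hx.symm hγW
    -- The tangent vector lies in the nested cone of order `i + 1`; `i` of these steps are undone by
    -- `T⁻ⁱ`, which leaves the first nested cone. Injectivity of `D Tⁱ` identifies the resulting
    -- vector with the derivative of the pulled-back curve.
    obtain ⟨u, hu, huD⟩ := (hcone x).1 (i + 1) hmem
    rw [hx, Function.iterate_succ_apply'] at hu huD
    have hsrc := S.T.map_target htgt
    have hTy : S.T (S.T.symm (S.T.symm^[i] (γ t))) = S.T.symm^[i] (γ t) := S.T.right_inv htgt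
    have hy := (symm_iterate_mem_dom hmap hb).1
    rw [Function.iterate_succ_apply', add_comm] at hy
    rw [add_comm, D_add hphase hmap hy, Function.iterate_one, hTy] at huD
    have hder := (hasDerivWithinAt_iterate_comp hphase hmap hσ ht' (hfwd t ht').1).congr
      (fun s hs => (hfwd s hs).2.symm) (hfwd t ht').2.symm
    have heq := (uniqueDiffOn_Icc_zero_one t ht').eq_deriv _ hg hder
    rw [← huD] at heq
    rw [← D_injective hphase hmap (hfwd t ht').1 heq]
    exact ⟨u, hu, rfl⟩
  refine ⟨⟨hσ, by simp [h0], hσ1, fun t ht => (hfwd t ht).1.1, fun t ht => ?_⟩, hfwd⟩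
  rcases ht.2.eq_or_lt with rfl | h
  -- At the endpoint on `S⁻` the first nested cone is defined by limits, and the derivative is the
  -- limit of those at earlier times.
  · refine Or.inr ⟨by rw [hσ1]; exact ha, ?_⟩
    have hc : ContinuousOn (fun t => (S.T.symm^[i] (γ t),
        derivWithin (fun t => S.T.symm^[i] (γ t)) (Icc 0 1) t)) (Icc 0 1) :=
      hσ.continuousOn.prodMk (hσ.continuousOn_derivWithin uniqueDiffOn_Icc_zero_one le_rfl)
    refine ((hc 1 ht).mono Ico_subset_Icc_self).mem_closure ?_ htan
    rw [closure_Ico zero_ne_one]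
    exact ht
  · obtain ⟨h1, h2⟩ := htan t ⟨ht.1, h⟩
    rw [hmap.target_eq] at h1
    exact Or.inl ⟨h1.2, h2⟩

/-! ### Cone vectors -/

lemma nestedCone_one_subset (hcone : S.ConeCondition) {z : Sp ν}
    (hz : z ∈ S.T.target) : S.nestedCone 1 z ⊆ S.cone z := by
  have h := hcone.invariant _ (S.T.map_target hz)
  rwa [S.T.right_inv hz] at h

lemma mem_closure_of_mem_coneOne (hmap : S.MapCondition) {z v : Sp ν} (hz : z ∈ S.M)
    (hv : v ∈ S.coneOne z) :
    (z, v) ∈ closure {p : Sp ν × Sp ν | p.1 ∈ S.T.target ∧ p.2 ∈ S.nestedCone 1 p.1} := by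
  rcases hv with ⟨h1, h2⟩ | ⟨-, h2⟩
  · exact subset_closure ⟨by rw [hmap.target_eq]; exact ⟨hz, h1⟩, h2⟩
  · exact h2

/-- Limits of cone vectors at points where the map is defined are cone vectors. -/
lemma mem_cone_of_mem_closure (hmap : S.MapCondition) (hcone : S.ConeCondition) {z v : Sp ν}
    (hz : z ∈ S.T.source)
    (h : (z, v) ∈ closure {p : Sp ν × Sp ν | p.1 ∈ S.T.target ∧ p.2 ∈ S.nestedCone 1 p.1}) :
    v ∈ S.cone z := by
  have hzM := source_subset hmap hz
  by_cases hv0 : v = 0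
  · rw [hv0]; exact hcone.zero_mem z hzM
  obtain ⟨x, hx, hlim⟩ := mem_closure_iff_seq_limit.1 h
  have hl1 : Tendsto (fun k => (x k).1) atTop (𝓝 z) := (continuous_fst.tendsto _).comp hlim
  have hl2 : Tendsto (fun k => (x k).2) atTop (𝓝 v) := (continuous_snd.tendsto _).comp hlim
  -- Continuity of the cone field compares unit vectors only.
  have hn : Tendsto (fun k => ‖(x k).2‖⁻¹ • (x k).2) atTop (𝓝 (‖v‖⁻¹ • v)) :=
    (hl2.norm.inv₀ (norm_ne_zero_iff.2 hv0)).smul hl2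
  have hmem : ‖v‖⁻¹ • v ∈ S.cone z := by
    rw [← (hcone.isClosed z hzM).closure_eq, Metric.mem_closure_iff]
    intro ε hε
    have e1 := hl1.eventually (hcone.continuous z hz (ε / 2) (half_pos hε))
    have e2 := hn.eventually (Metric.ball_mem_nhds _ (half_pos hε))
    have e3 := hl2.eventually_ne hv0
    obtain ⟨k, hk1, hk2, hk3⟩ := (e1.and (e2.and e3)).exists
    have hkM := target_subset hmap (hx k).1
    obtain ⟨u, hu, hlt⟩ := hk1.1 (‖(x k).2‖⁻¹ • (x k).2)
      (hcone.smul_mem _ hkM _ (nestedCone_one_subset hcone (hx k).1 (hx k).2) _)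
      (norm_smul_inv_norm (𝕜 := ℝ) hk3)
    refine ⟨u, hu, ?_⟩
    rw [dist_comm] at hk2
    rw [← dist_eq_norm, dist_comm] at hlt
    linarith [dist_triangle (‖v‖⁻¹ • v) (‖(x k).2‖⁻¹ • (x k).2) u]
  have := hcone.smul_mem z hzM _ hmem ‖v‖
  rwa [smul_smul, mul_inv_cancel₀ (norm_ne_zero_iff.2 hv0), one_smul] at this

lemma coneOne_subset_cone (hmap : S.MapCondition) (hcone : S.ConeCondition) {z : Sp ν}
    (hz : z ∈ S.T.source) : S.coneOne z ⊆ S.cone z := fun _ hv =>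
  mem_cone_of_mem_closure hmap hcone hz
    (mem_closure_of_mem_coneOne hmap (source_subset hmap hz) hv)

lemma smul_mem_nestedCone_one (hmap : S.MapCondition) (hcone : S.ConeCondition) {z v : Sp ν}
    (hz : z ∈ S.T.target) (hv : v ∈ S.nestedCone 1 z) (c : ℝ) : c • v ∈ S.nestedCone 1 z := by
  obtain ⟨u, hu, rfl⟩ := hv
  exact ⟨c • u, hcone.smul_mem _ (source_subset hmap (S.T.map_target hz)) u hu c,
    map_smul _ _ _⟩

lemma smul_mem_coneOne (hmap : S.MapCondition) (hcone : S.ConeCondition) {z v : Sp ν}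
    (hz : z ∈ S.M) (hv : v ∈ S.coneOne z) (c : ℝ) : c • v ∈ S.coneOne z := by
  rcases hv with ⟨h1, h2⟩ | ⟨h1, h2⟩
  · exact Or.inl ⟨h1, smul_mem_nestedCone_one hmap hcone
      (by rw [hmap.target_eq]; exact ⟨hz, h1⟩) h2 c⟩
  · refine Or.inr ⟨h1, ?_⟩
    have hc : Continuous fun p : Sp ν × Sp ν => (p.1, c • p.2) := by fun_prop
    have hm := map_mem_closure
      (t := {p : Sp ν × Sp ν | p.1 ∈ S.T.target ∧ p.2 ∈ S.nestedCone 1 p.1}) hc h2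
      fun p hp => ⟨hp.1, smul_mem_nestedCone_one hmap hcone hp.1 hp.2 c⟩
    exact hm

lemma D_mem_cone (hphase : S.PhaseSpaceCondition) (hmap : S.MapCondition)
    (hcone : S.ConeCondition) {n : ℕ} {z v : Sp ν} (hz : z ∈ S.dom n) (hv : v ∈ S.cone z) :
    S.D n z v ∈ S.cone (S.T^[n] z) := by
  induction n with
  | zero => rwa [D_zero_apply]
  | succ n ih =>
    rw [D_succ_apply hphase hmap hz, Function.iterate_succ_apply']
    exact hcone.invariant _ (hz.2 n n.lt_succ_self) ⟨_, ih (dom_anti n.le_succ hz), rfl⟩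

/-! ### Growth of the norm of cone vectors along orbits. -/

namespace IsIncreasingNorm

variable {N : Sp ν → Sp ν → ℝ}

lemma nonneg (hnorm : S.IsIncreasingNorm N) {z v : Sp ν} (hz : z ∈ S.M) (hv : v ∈ S.cone z) :
    0 ≤ N z v := by
  obtain ⟨a, ha, b, -, h⟩ := hnorm.locally_equivalent z hz
  exact (by positivity : 0 ≤ a * ‖v‖).trans (h.self_of_nhds v hv).1

lemma le_map (hnorm : S.IsIncreasingNorm N) (hmap : S.MapCondition) {z v : Sp ν}
    (hz : z ∈ S.T.source) (hv : v ∈ S.cone z) : N z v ≤ N (S.T z) (S.D 1 z v) := by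
  obtain ⟨κ, hκ, -⟩ := hnorm.increasing
  obtain ⟨h1, h2⟩ := hκ z hz
  have := hnorm.nonneg (source_subset hmap hz) hv
  nlinarith [h2 v hv]

/-- Near each point of the phase space the norm is increased by a factor bounded away
from `1`. -/
lemma exists_factor (hnorm : S.IsIncreasingNorm N) {z₀ : Sp ν} (hz₀ : z₀ ∈ S.M) :
    ∃ κ > (1 : ℝ), ∀ᶠ z in 𝓝 z₀, z ∈ S.T.source → ∀ v ∈ S.cone z, 0 ≤ N z v →
      κ * N z v ≤ N (S.T z) (S.D 1 z v) := by
  obtain ⟨κ, hκ, hne⟩ := hnorm.increasing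
  -- If no factor worked, points with factors below `1 + 1/(n+1)` would converge to `z₀`, contrary
  -- to the assumption on `κ`.
  by_contra! hcon
  have hex : ∀ n : ℕ, ∃ z, z ∈ S.T.source ∧ dist z z₀ < 1 / (n + 1 : ℝ) ∧
      κ z < 1 + 1 / (n + 1 : ℝ) := by
    intro n
    have hpos : (0 : ℝ) < 1 / (n + 1 : ℝ) := Nat.one_div_pos_of_nat
    have hf := hcon (1 + 1 / (n + 1 : ℝ)) (by linarith)
    obtain ⟨z, hz, hz'⟩ := (hf.and_eventually (Metric.ball_mem_nhds z₀ hpos)).exists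
    obtain ⟨hs, v, hv, h0, hlt⟩ := hz
    refine ⟨z, hs, hz', ?_⟩
    by_contra! hle
    exact absurd hlt (not_lt.2 (le_trans (by gcongr) ((hκ z hs).2 v hv)))
  choose x hx1 hx2 hx3 using hex
  have hlim : Tendsto (fun n : ℕ => 1 / (n + 1 : ℝ)) atTop (𝓝 0) :=
    tendsto_one_div_add_atTop_nhds_zero_nat
  have hmem : z₀ ∈ {z ∈ S.M | ∃ x : ℕ → Sp ν, (∀ n, x n ∈ S.T.source) ∧
      Tendsto x atTop (𝓝 z) ∧ Tendsto (fun n => κ (x n)) atTop (𝓝 1)} := by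
    refine ⟨hz₀, x, hx1, tendsto_iff_dist_tendsto_zero.2 ?_, ?_⟩
    · exact squeeze_zero (fun _ => dist_nonneg) (fun n => (hx2 n).le) hlim
    · have h2 : Tendsto (fun n : ℕ => 1 + 1 / (n + 1 : ℝ)) atTop (𝓝 1) := by
        simpa using hlim.const_add 1
      exact tendsto_of_tendsto_of_tendsto_of_le_of_le tendsto_const_nhds h2
        (fun n => (hκ _ (hx1 n)).1.le) (fun n => (hx3 n).le)
  rw [hne] at hmem
  exact hmem

lemma monotone_orbit (hnorm : S.IsIncreasingNorm N) (hphase : S.PhaseSpaceCondition)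
    (hmap : S.MapCondition) (hcone : S.ConeCondition) {j n : ℕ} (hjn : j ≤ n) {w v : Sp ν}
    (hw : w ∈ S.dom n) (hv : v ∈ S.cone w) :
    N (S.T^[j] w) (S.D j w v) ≤ N (S.T^[n] w) (S.D n w v) := by
  induction n, hjn using Nat.le_induction with
  | base => exact le_rfl
  | succ n _ ih =>
    have hw' := dom_anti n.le_succ hw
    refine (ih hw').trans ?_
    rw [D_succ_apply hphase hmap hw, Function.iterate_succ_apply']
    exact hnorm.le_map hmap (hw.2 n n.lt_succ_self) (D_mem_cone hphase hmap hcone hw' hv)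

open Classical in
/-- Each passage through a set where the norm is increased by the factor `κ` contributes that
factor. -/
lemma pow_card_mul_le (hnorm : S.IsIncreasingNorm N) (hphase : S.PhaseSpaceCondition)
    (hmap : S.MapCondition) (hcone : S.ConeCondition) {κ : ℝ} (hκ0 : 0 ≤ κ) {B : Set (Sp ν)}
    (hκ : ∀ z ∈ B, z ∈ S.T.source → ∀ v ∈ S.cone z, κ * N z v ≤ N (S.T z) (S.D 1 z v))
    {p n : ℕ} (hpn : p ≤ n) {w v : Sp ν} (hw : w ∈ S.dom n) (hv : v ∈ S.cone w) :
    κ ^ ((Finset.Ico p n).filter fun j => S.T^[j] w ∈ B).card * N (S.T^[p] w) (S.D p w v) ≤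
      N (S.T^[n] w) (S.D n w v) := by
  induction n, hpn using Nat.le_induction with
  | base => simp
  | succ n hpn ih =>
    have hw' := dom_anti n.le_succ hw
    have hs := hw.2 n n.lt_succ_self
    have hc := D_mem_cone hphase hmap hcone hw' hv
    rw [D_succ_apply hphase hmap hw, Function.iterate_succ_apply',
      ← Finset.insert_Ico_right_eq_Ico_add_one hpn, Finset.filter_insert]
    split_ifs with hB
    · rw [Finset.card_insert_of_notMem (by simp), pow_succ', mul_assoc]
      exact (mul_le_mul_of_nonneg_left (ih hw') hκ0).trans (hκ _ hB hs _ hc)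
    · exact (ih hw').trans (hnorm.le_map hmap hs hc)

end IsIncreasingNorm

end SingularSystem

/-! ### Lengths of curves, and continuation arguments along `[0, 1]`. -/

section Curves

variable {E : Type*} [NormedAddCommGroup E] [NormedSpace ℝ E]

lemma continuousOn_norm_derivWithin {γ : ℝ → E} (hγ : ContDiffOn ℝ 1 γ (Icc 0 1)) :
    ContinuousOn (fun t => ‖derivWithin γ (Icc 0 1) t‖) (Icc 0 1) :=
  (hγ.continuousOn_derivWithin uniqueDiffOn_Icc_zero_one le_rfl).norm

lemma intervalIntegrable_norm_derivWithin {γ : ℝ → E} (hγ : ContDiffOn ℝ 1 γ (Icc 0 1)) {s t : ℝ}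
    (hs : s ∈ Icc (0 : ℝ) 1) (ht : t ∈ Icc (0 : ℝ) 1) :
    IntervalIntegrable (fun t => ‖derivWithin γ (Icc 0 1) t‖) volume s t :=
  ((continuousOn_norm_derivWithin hγ).mono (uIcc_subset_Icc hs ht)).intervalIntegrable

lemma curveLength_eq_ofReal_integral {γ : ℝ → E} (hγ : ContDiffOn ℝ 1 γ (Icc 0 1)) :
    curveLength γ = ENNReal.ofReal (∫ t in (0 : ℝ)..1, ‖derivWithin γ (Icc 0 1) t‖) := by
  rw [intervalIntegral.integral_of_le zero_le_one, ← integral_Icc_eq_integral_Ioc,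
    ofReal_integral_eq_lintegral_ofReal
      (continuousOn_norm_derivWithin hγ).integrableOn_Icc (ae_of_all _ fun _ => norm_nonneg _)]
  simp only [curveLength, ofReal_norm]

/-- Comparison of the lengths of parts of two curves. -/
lemma integral_norm_derivWithin_le {F : Type*} [NormedAddCommGroup F] [NormedSpace ℝ F]
    {σ : ℝ → E} {γ : ℝ → F} (hσ : ContDiffOn ℝ 1 σ (Icc 0 1)) (hγ : ContDiffOn ℝ 1 γ (Icc 0 1))
    {s t c : ℝ} (hs : 0 ≤ s) (hst : s ≤ t) (ht : t ≤ 1) (hc : 0 ≤ c)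
    (h : ∀ u ∈ Ioo s t, ‖derivWithin σ (Icc 0 1) u‖ ≤ c * ‖derivWithin γ (Icc 0 1) u‖) :
    ∫ u in s..t, ‖derivWithin σ (Icc 0 1) u‖ ≤
      c * ∫ u in (0 : ℝ)..1, ‖derivWithin γ (Icc 0 1) u‖ := by
  have hsI : s ∈ Icc (0 : ℝ) 1 := ⟨hs, hst.trans ht⟩
  have htI : t ∈ Icc (0 : ℝ) 1 := ⟨hs.trans hst, ht⟩
  calc _ ≤ ∫ u in s..t, c * ‖derivWithin γ (Icc 0 1) u‖ :=
        intervalIntegral.integral_mono_on_of_le_Ioo hst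
          (intervalIntegrable_norm_derivWithin hσ hsI htI)
          ((intervalIntegrable_norm_derivWithin hγ hsI htI).const_mul c) h
    _ = c * ∫ u in s..t, ‖derivWithin γ (Icc 0 1) u‖ := intervalIntegral.integral_const_mul _ _
    _ ≤ _ := by
        gcongr
        exact intervalIntegral.integral_mono_interval hs hst ht
          (ae_of_all _ fun _ => norm_nonneg _)
          (intervalIntegrable_norm_derivWithin hγ (by simp) (by simp))

lemma dist_le_integral_norm_derivWithin [CompleteSpace E] {σ : ℝ → E}
    (hσ : ContDiffOn ℝ 1 σ (Icc 0 1)) {s t : ℝ} (hs : 0 ≤ s) (hst : s ≤ t) (ht : t ≤ 1) :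
    dist (σ s) (σ t) ≤ ∫ u in s..t, ‖derivWithin σ (Icc 0 1) u‖ := by
  have hsub : Icc s t ⊆ Icc 0 1 := Icc_subset_Icc hs ht
  have hd : ∀ u ∈ Ioo s t, HasDerivAt σ (derivWithin σ (Icc 0 1) u) u := fun u hu =>
    ((hσ.differentiableOn one_ne_zero) u
      (hsub (Ioo_subset_Icc_self hu))).hasDerivWithinAt.hasDerivAt
      (Icc_mem_nhds (hs.trans_lt hu.1) (hu.2.trans_le ht))
  have hc : ContinuousOn (derivWithin σ (Icc 0 1)) (uIcc s t) := by
    rw [uIcc_of_le hst]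
    exact (hσ.continuousOn_derivWithin uniqueDiffOn_Icc_zero_one le_rfl).mono hsub
  rw [dist_comm, dist_eq_norm, ← intervalIntegral.integral_eq_sub_of_hasDerivAt_of_le hst
    (hσ.continuousOn.mono hsub) hd hc.intervalIntegrable]
  exact intervalIntegral.norm_integral_le_integral_norm hst

lemma HasDerivWithinAt.comp_affine {γ : ℝ → E} {s u : ℝ} {v : E} (hs : s ∈ Icc (0 : ℝ) 1)
    (hγ : HasDerivWithinAt γ v (Icc 0 1) (s + (1 - s) * u)) :
    HasDerivWithinAt (fun u => γ (s + (1 - s) * u)) ((1 - s) • v) (Icc 0 1) u := by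
  have h : HasDerivWithinAt (fun u : ℝ => s + (1 - s) * u) (1 - s) (Icc 0 1) u := by
    simpa using (((hasDerivAt_id u).const_mul (1 - s)).const_add s).hasDerivWithinAt
  have hmaps : MapsTo (fun u : ℝ => s + (1 - s) * u) (Icc 0 1) (Icc 0 1) := fun x hx =>
    ⟨by nlinarith [hs.1, hs.2, hx.1, hx.2], by nlinarith [hs.1, hs.2, hx.1, hx.2]⟩
  exact hγ.scomp u h hmaps

/-- A property that is open along `[0, 1]`, and holds at `t` if it holds before `t`, holds
throughout. -/
lemma forall_Icc_of_forall_lt {P : ℝ → Prop} (hcl : IsClosed {t | t ∈ Icc (0 : ℝ) 1 ∧ ¬ P t})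
    (h : ∀ t ∈ Icc (0 : ℝ) 1, (∀ s ∈ Icc (0 : ℝ) 1, s < t → P s) → P t) :
    ∀ t ∈ Icc (0 : ℝ) 1, P t := by
  by_contra! hcon
  obtain ⟨t, ht, hPt⟩ := hcon
  have hcomp : IsCompact {t | t ∈ Icc (0 : ℝ) 1 ∧ ¬ P t} :=
    isCompact_Icc.of_isClosed_subset hcl fun _ h => h.1
  obtain ⟨t₀, ht₀, hmin⟩ := hcomp.exists_isLeast ⟨t, ht, hPt⟩
  refine ht₀.2 (h t₀ ht₀.1 fun s hs hlt => ?_)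
  by_contra hPs
  exact absurd (hmin ⟨hs, hPs⟩) (not_le.2 hlt)

/-- A property that is open along `[0, 1]`, and holds at `t` if it holds after `t`, holds
throughout. -/
lemma forall_Icc_of_forall_gt {P : ℝ → Prop} (hcl : IsClosed {t | t ∈ Icc (0 : ℝ) 1 ∧ ¬ P t})
    (h : ∀ t ∈ Icc (0 : ℝ) 1, (∀ s ∈ Icc (0 : ℝ) 1, t < s → P s) → P t) :
    ∀ t ∈ Icc (0 : ℝ) 1, P t := by
  by_contra! hcon
  obtain ⟨t, ht, hPt⟩ := hcon
  have hcomp : IsCompact {t | t ∈ Icc (0 : ℝ) 1 ∧ ¬ P t} :=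
    isCompact_Icc.of_isClosed_subset hcl fun _ h => h.1
  obtain ⟨t₀, ht₀, hmax⟩ := hcomp.exists_isGreatest ⟨t, ht, hPt⟩
  refine ht₀.2 (h t₀ ht₀.1 fun s hs hlt => ?_)
  by_contra hPs
  exact absurd (hmax ⟨hs, hPs⟩) (not_le.2 hlt)

end Curves

/-! ### Contraction of unstable curves under pull-back, measured by visits to a ball. -/

namespace SingularSystem

variable {ν : ℕ} {S : SingularSystem ν}

/-- The final part of an unstable curve, reparametrized. -/
lemma IsUnstableCurve.comp_affine (hmap : S.MapCondition) (hcone : S.ConeCondition)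
    {σ : ℝ → Sp ν} {x y : Sp ν} (hσ : S.IsUnstableCurve σ x y) {s : ℝ}
    (hs : s ∈ Icc (0 : ℝ) 1) :
    S.IsUnstableCurve (fun u => σ (s + (1 - s) * u)) (σ s) y ∧
      curveLength (fun u => σ (s + (1 - s) * u)) =
        ENNReal.ofReal (∫ u in s..1, ‖derivWithin σ (Icc 0 1) u‖) := by
  have hmaps : ∀ u ∈ Icc (0 : ℝ) 1, s + (1 - s) * u ∈ Icc (0 : ℝ) 1 := fun u hu =>
    ⟨by nlinarith [hs.1, hs.2, hu.1, hu.2], by nlinarith [hs.1, hs.2, hu.1, hu.2]⟩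
  have hC : ContDiffOn ℝ 1 (fun u => σ (s + (1 - s) * u)) (Icc 0 1) :=
    hσ.contDiffOn.comp (by fun_prop) hmaps
  have hder : ∀ u ∈ Icc (0 : ℝ) 1, derivWithin (fun u => σ (s + (1 - s) * u)) (Icc 0 1) u =
      (1 - s) • derivWithin σ (Icc 0 1) (s + (1 - s) * u) := fun u hu =>
    (HasDerivWithinAt.comp_affine hs ((hσ.contDiffOn.differentiableOn one_ne_zero) _
      (hmaps u hu)).hasDerivWithinAt).derivWithin (uniqueDiffOn_Icc_zero_one u hu)
  refine ⟨⟨hC, by simp, by simp [hσ.finish], fun u hu => hσ.mem _ (hmaps u hu), fun u hu => ?_⟩, ?_⟩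
  · rw [hder u hu]
    exact smul_mem_coneOne hmap hcone (hσ.mem _ (hmaps u hu)) (hσ.tangent _ (hmaps u hu)) _
  · rw [curveLength_eq_ofReal_integral hC]
    congr 1
    have h1 : ∫ u in (0 : ℝ)..1, ‖derivWithin (fun u => σ (s + (1 - s) * u)) (Icc 0 1) u‖ =
        ∫ u in (0 : ℝ)..1, (1 - s) * ‖derivWithin σ (Icc 0 1) (s + (1 - s) * u)‖ := by
      refine intervalIntegral.integral_congr fun u hu => ?_
      rw [uIcc_of_le zero_le_one] at hu
      simp only [hder u hu, norm_smul, Real.norm_eq_abs, abs_of_nonneg (sub_nonneg.2 hs.2)]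
    rw [h1, intervalIntegral.integral_const_mul]
    have h2 := intervalIntegral.mul_integral_comp_add_mul (a := 0) (b := 1)
      (f := fun u => ‖derivWithin σ (Icc 0 1) u‖) (1 - s) s
    rw [h2]
    simp

/-- The remaining part of the curve, from `σ s` on, is a competitor in the unstable distance to `A`.
-/
lemma IsUnstableCurve.mem_tube (hmap : S.MapCondition) (hcone : S.ConeCondition)
    {σ : ℝ → Sp ν} {x y : Sp ν} (hσ : S.IsUnstableCurve σ x y) {A : Set (Sp ν)} (hy : y ∈ A)
    {s ε : ℝ} (hs : s ∈ Icc (0 : ℝ) 1)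
    (h : ∫ u in s..1, ‖derivWithin σ (Icc 0 1) u‖ ≤ ε) : σ s ∈ S.tube A ε := by
  obtain ⟨h1, h2⟩ := hσ.comp_affine hmap hcone hs
  have h3 : S.unstableDist (σ s) y ≤ curveLength fun u => σ (s + (1 - s) * u) :=
    iInf₂_le (fun u => σ (s + (1 - s) * u)) h1
  refine ⟨hσ.mem s hs, (iInf₂_le y hy).trans (h3.trans ?_)⟩
  rw [h2]
  exact ENNReal.ofReal_le_ofReal h

/-- A ball in which the increasing norm is comparable with the Euclidean norm and is increased by
the factor `κ`, and to which the non-contraction condition applies. -/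
structure IsExpansionBall (S : SingularSystem ν) (N : Sp ν → Sp ν → ℝ) (z₀ : Sp ν)
    (r a b κ K ε₀ : ℝ) : Prop where
  r_pos : 0 < r
  a_pos : 0 < a
  b_pos : 0 < b
  one_lt : 1 < κ
  K_pos : 0 < K
  ε₀_pos : 0 < ε₀
  le_norm : ∀ z ∈ Metric.ball z₀ (2 * r), ∀ v ∈ S.cone z, a * ‖v‖ ≤ N z v
  norm_le : ∀ z ∈ Metric.ball z₀ (2 * r), ∀ v ∈ S.cone z, N z v ≤ b * ‖v‖
  factor : ∀ z ∈ Metric.ball z₀ (2 * r), z ∈ S.T.source → ∀ v ∈ S.cone z,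
    κ * N z v ≤ N (S.T z) (S.D 1 z v)
  noncontraction : ∀ w ∈ S.tube S.Sminus ε₀, ∀ n > 0, w ∈ S.dom n →
    S.T^[n] w ∈ Metric.ball z₀ (2 * r) → ∀ v ∈ S.coneOne w, K * ‖v‖ ≤ ‖S.D n w v‖

lemma exists_isExpansionBall (hphase : S.PhaseSpaceCondition) (hnc : S.NonContractionCondition)
    {N : Sp ν → Sp ν → ℝ} (hnorm : S.IsIncreasingNorm N) {z₀ : Sp ν} (hz₀ : z₀ ∈ S.M) :
    ∃ r a b κ K ε₀, S.IsExpansionBall N z₀ r a b κ K ε₀ := by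
  obtain ⟨U₀, hU₀, ε₀, hε₀, K, hK, hnc'⟩ := hnc z₀ hz₀
  obtain ⟨a, ha, b, hb, hab⟩ := hnorm.locally_equivalent z₀ hz₀
  obtain ⟨κ, hκ, hfac⟩ := hnorm.exists_factor hz₀
  have hM : ∀ᶠ z in 𝓝 z₀, z ∈ S.M := hphase.isOpen.mem_nhds hz₀
  have hU : ∀ᶠ z in 𝓝 z₀, z ∈ U₀ := hU₀
  obtain ⟨ρ, hρ, hsub⟩ := Metric.eventually_nhds_iff_ball.1 (hM.and (hU.and (hab.and hfac)))
  have h2 : 2 * (ρ / 2) = ρ := by ring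
  refine ⟨ρ / 2, a, b, κ, K, ε₀, half_pos hρ, ha, hb, hκ, hK, hε₀, ?_, ?_, ?_, ?_⟩ <;> rw [h2]
  · exact fun z hz v hv => ((hsub z hz).2.2.1 v hv).1
  · exact fun z hz v hv => ((hsub z hz).2.2.1 v hv).2
  · exact fun z hz hs v hv => (hsub z hz).2.2.2 hs v hv (hnorm.nonneg (hsub z hz).1 hv)
  · exact fun w hw n hn hd hB => hnc' w hw n hn hd (hsub _ hB).2.1

/-- The length of the image of a curve under `Tⁱ`. -/
noncomputable def imageLength (S : SingularSystem ν) (i : ℕ) (σ : ℝ → Sp ν) : ℝ :=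
  ∫ t in (0 : ℝ)..1, ‖derivWithin (fun t => S.T^[i] (σ t)) (Icc 0 1) t‖

open Classical in
/-- The number of visits of the orbit of `w` to `U` at times in `[p, n)`. -/
noncomputable def visits (S : SingularSystem ν) (U : Set (Sp ν)) (p n : ℕ) (w : Sp ν) : ℕ :=
  ((Finset.Ico p n).filter fun j => S.T^[j] w ∈ U).card

/-- The increasing norm and the Euclidean norm are comparable only near `z₀`. Starting the count at
the first visit after `p` loses no visit and puts the orbit where they can be compared. -/
lemma exists_first_visit (U : Set (Sp ν)) {p i : ℕ} (hpi : p ≤ i) {w : Sp ν}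
    (hi : S.T^[i] w ∈ U) :
    ∃ n, p ≤ n ∧ n ≤ i ∧ S.T^[n] w ∈ U ∧ S.visits U n i w = S.visits U p i w := by
  classical
  have hex : ∃ n, p ≤ n ∧ S.T^[n] w ∈ U := ⟨i, hpi, hi⟩
  obtain ⟨h1, h2⟩ := Nat.find_spec hex
  refine ⟨Nat.find hex, h1, Nat.find_min' hex ⟨hpi, hi⟩, h2, ?_⟩
  unfold visits
  congr 1
  ext j
  simp only [Finset.mem_filter, Finset.mem_Ico]
  constructor
  · exact fun ⟨⟨h3, h4⟩, h5⟩ => ⟨⟨h1.trans h3, h4⟩, h5⟩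
  · exact fun ⟨⟨h3, h4⟩, h5⟩ => ⟨⟨Nat.find_min' hex ⟨h3, h5⟩, h4⟩, h5⟩

namespace IsExpansionBall

variable {N : Sp ν → Sp ν → ℝ} {z₀ : Sp ν} {r a b κ K ε₀ : ℝ}

/-- If the image of an unstable curve under `Tⁱ` is short, then so are the earlier images that
start near `z₀`. -/
lemma iterate_mem_ball (hB : S.IsExpansionBall N z₀ r a b κ K ε₀) (hphase : S.PhaseSpaceCondition)
    (hmap : S.MapCondition) (hcone : S.ConeCondition) (hnorm : S.IsIncreasingNorm N) {i : ℕ}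
    (hi : 0 < i) {σ : ℝ → Sp ν} {w y : Sp ν} (hσ : S.IsUnstableCurve σ w y)
    (hdom : ∀ t ∈ Icc (0 : ℝ) 1, σ t ∈ S.dom i) (hw : S.T^[i] w ∈ Metric.ball z₀ r)
    (hlen : S.imageLength i σ < r) (hlen' : b / a * S.imageLength i σ < r) {j : ℕ} (hj : j ≤ i)
    (hwj : S.T^[j] w ∈ Metric.ball z₀ r) :
    ∀ t ∈ Icc (0 : ℝ) 1, S.T^[j] (σ t) ∈ Metric.ball z₀ (2 * r) := by
  have hC : ∀ j ≤ i, ContDiffOn ℝ 1 (fun t => S.T^[j] (σ t)) (Icc 0 1) := fun j hj =>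
    (contDiffOn_iterate hphase hmap j).comp hσ.contDiffOn fun t ht => dom_anti hj (hdom t ht)
  have hder : ∀ j ≤ i, ∀ t ∈ Icc (0 : ℝ) 1, derivWithin (fun t => S.T^[j] (σ t)) (Icc 0 1) t =
      S.D j (σ t) (derivWithin σ (Icc 0 1) t) := fun j hj t ht =>
    (hasDerivWithinAt_iterate_comp hphase hmap hσ.contDiffOn ht
      (dom_anti hj (hdom t ht))).derivWithin (uniqueDiffOn_Icc_zero_one t ht)
  have hcv : ∀ t ∈ Icc (0 : ℝ) 1, derivWithin σ (Icc 0 1) t ∈ S.cone (σ t) := fun t ht =>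
    coneOne_subset_cone hmap hcone (mem_source_of_mem_dom hi (hdom t ht)) (hσ.tangent t ht)
  have key : ∀ j, S.T^[j] w ∈ Metric.ball z₀ r → ∀ t, dist (S.T^[j] (σ 0)) (S.T^[j] (σ t)) < r →
      S.T^[j] (σ t) ∈ Metric.ball z₀ (2 * r) := by
    intro j hwj t hd
    rw [hσ.start, dist_comm] at hd
    rw [Metric.mem_ball] at hwj ⊢
    linarith [dist_triangle (S.T^[j] (σ t)) (S.T^[j] w) z₀]
  have hlast : ∀ t ∈ Icc (0 : ℝ) 1, S.T^[i] (σ t) ∈ Metric.ball z₀ (2 * r) := by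
    intro t ht
    refine key i hw t (lt_of_le_of_lt ?_ hlen)
    refine (dist_le_integral_norm_derivWithin (hC i le_rfl) le_rfl ht.1 ht.2).trans ?_
    simpa [imageLength] using integral_norm_derivWithin_le (hC i le_rfl) (hC i le_rfl) le_rfl ht.1 ht.2
      zero_le_one (fun u _ => by rw [one_mul])
  -- Continuation from `t = 0`: while the image at time `j` stays in the double ball, monotonicity
  -- of the norm along orbits bounds its length by `b / a` times that of the image at time `i`,
  -- hence by `r`, so it cannot leave.
  refine forall_Icc_of_forall_lt ?_ ?_
  · exact (hC j hj).continuousOn.preimage_isClosed_of_isClosed isClosed_Icc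
      Metric.isOpen_ball.isClosed_compl
  · intro t ht hlt
    refine key j hwj t (lt_of_le_of_lt ?_ hlen')
    refine (dist_le_integral_norm_derivWithin (hC j hj) le_rfl ht.1 ht.2).trans ?_
    refine integral_norm_derivWithin_le (hC j hj) (hC i le_rfl) le_rfl ht.1 ht.2
      (div_nonneg hB.b_pos.le hB.a_pos.le) fun u hu => ?_
    have huI : u ∈ Icc (0 : ℝ) 1 := ⟨hu.1.le, hu.2.le.trans ht.2⟩
    rw [hder j hj u huI, hder i le_rfl u huI, div_mul_eq_mul_div, le_div_iff₀ hB.a_pos, mul_comm]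
    have hd := hdom u huI
    exact (hB.le_norm _ (hlt u huI hu.2) _
        (D_mem_cone hphase hmap hcone (dom_anti hj hd) (hcv u huI))).trans
      ((hnorm.monotone_orbit hphase hmap hcone hj hd (hcv u huI)).trans
        (hB.norm_le _ (hlast u huI) _ (D_mem_cone hphase hmap hcone hd (hcv u huI))))

/-- An unstable curve that ends in `S⁻`, and whose image under `Tⁱ` is short and starts near `z₀`,
is expanded by `Tⁱ` at a rate exponential in the number of visits.  The second bound is for curves
on which the iterates of order at least `p` expand by the factor `R`. -/
lemma integral_norm_derivWithin_le_visits (hB : S.IsExpansionBall N z₀ r a b κ K ε₀)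
    (hphase : S.PhaseSpaceCondition) (hmap : S.MapCondition) (hcone : S.ConeCondition)
    (hnorm : S.IsIncreasingNorm N) {p i : ℕ} (hp : 0 < p) (hpi : p ≤ i) {σ : ℝ → Sp ν}
    {w y : Sp ν} (hσ : S.IsUnstableCurve σ w y) (hy : y ∈ S.Sminus)
    (hdom : ∀ t ∈ Icc (0 : ℝ) 1, σ t ∈ S.dom i) (hw : S.T^[i] w ∈ Metric.ball z₀ r)
    (hlen : S.imageLength i σ < r) (hlen' : b / a * S.imageLength i σ < r)
    (hε : b / (a * K) * S.imageLength i σ < ε₀) :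
    ∫ t in (0 : ℝ)..1, ‖derivWithin σ (Icc 0 1) t‖ ≤
        b / (a * K) * (κ⁻¹) ^ S.visits (Metric.ball z₀ r) p i w * S.imageLength i σ ∧
      ∀ R > 0, (∀ t ∈ Icc (0 : ℝ) 1, ∀ n ≥ p, σ t ∈ S.dom n → ∀ v ∈ S.coneOne (σ t),
          R * ‖v‖ ≤ N (S.T^[n] (σ t)) (S.D n (σ t) v)) →
        ∫ t in (0 : ℝ)..1, ‖derivWithin σ (Icc 0 1) t‖ ≤
          b / R * (κ⁻¹) ^ S.visits (Metric.ball z₀ r) p i w * S.imageLength i σ := by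
  classical
  have hi : 0 < i := hp.trans_le hpi
  have hκ0 : 0 < κ := one_pos.trans hB.one_lt
  have hbpos := hB.b_pos
  have hapos := hB.a_pos
  have hKpos := hB.K_pos
  obtain ⟨n, hpn, hni, hwn, hvis⟩ := exists_first_visit (Metric.ball z₀ r) hpi hw
  rw [← hvis]
  set k := S.visits (Metric.ball z₀ r) n i w with hk
  have hC : ContDiffOn ℝ 1 (fun t => S.T^[i] (σ t)) (Icc 0 1) :=
    (contDiffOn_iterate hphase hmap i).comp hσ.contDiffOn hdom
  have hder : ∀ t ∈ Icc (0 : ℝ) 1, derivWithin (fun t => S.T^[i] (σ t)) (Icc 0 1) t =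
      S.D i (σ t) (derivWithin σ (Icc 0 1) t) := fun t ht =>
    (hasDerivWithinAt_iterate_comp hphase hmap hσ.contDiffOn ht
      (hdom t ht)).derivWithin (uniqueDiffOn_Icc_zero_one t ht)
  have hcv : ∀ t ∈ Icc (0 : ℝ) 1, derivWithin σ (Icc 0 1) t ∈ S.cone (σ t) := fun t ht =>
    coneOne_subset_cone hmap hcone (mem_source_of_mem_dom hi (hdom t ht)) (hσ.tangent t ht)
  have hball : ∀ j ≤ i, S.T^[j] w ∈ Metric.ball z₀ r → ∀ t ∈ Icc (0 : ℝ) 1,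
      S.T^[j] (σ t) ∈ Metric.ball z₀ (2 * r) := fun j hj hwj =>
    hB.iterate_mem_ball hphase hmap hcone hnorm hi hσ hdom hw hlen hlen' hj hwj
  -- Visits are counted for the starting point `w` and the ball of radius `r`; at these times the
  -- whole image of the curve is in the double ball, so all its tangent vectors gain the factor `κ`.
  have hexp : ∀ t ∈ Icc (0 : ℝ) 1,
      κ ^ k * N (S.T^[n] (σ t)) (S.D n (σ t) (derivWithin σ (Icc 0 1) t)) ≤
        b * ‖derivWithin (fun t => S.T^[i] (σ t)) (Icc 0 1) t‖ := by
    intro t ht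
    have hd := hdom t ht
    have h1 := hnorm.pow_card_mul_le hphase hmap hcone hκ0.le hB.factor hni hd (hcv t ht)
    have h2 := hB.norm_le _ (hball i le_rfl hw t ht) _ (D_mem_cone hphase hmap hcone hd (hcv t ht))
    rw [hder t ht]
    refine le_trans ?_ (h1.trans h2)
    refine mul_le_mul_of_nonneg_right (pow_le_pow_right₀ hB.one_lt.le (Finset.card_le_card ?_))
      (hnorm.nonneg (iterate_mem_M hmap (dom_anti hni hd))
        (D_mem_cone hphase hmap hcone (dom_anti hni hd) (hcv t ht)))
    intro j hj
    rw [Finset.mem_filter, Finset.mem_Ico] at hj ⊢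
    exact ⟨hj.1, hball j hj.1.2.le hj.2 t ht⟩
  have hκk : 0 < κ ^ k := pow_pos hκ0 k
  have hbound : ∀ (c : ℝ), 0 < c → ∀ t ∈ Icc (0 : ℝ) 1, c * ‖derivWithin σ (Icc 0 1) t‖ ≤
      N (S.T^[n] (σ t)) (S.D n (σ t) (derivWithin σ (Icc 0 1) t)) →
      ‖derivWithin σ (Icc 0 1) t‖ ≤ b / c * (κ⁻¹) ^ k *
        ‖derivWithin (fun t => S.T^[i] (σ t)) (Icc 0 1) t‖ := by
    intro c hc t ht h
    have h1 : κ ^ k * (c * ‖derivWithin σ (Icc 0 1) t‖) ≤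
        b * ‖derivWithin (fun t => S.T^[i] (σ t)) (Icc 0 1) t‖ :=
      (mul_le_mul_of_nonneg_left h hκk.le).trans (hexp t ht)
    rw [inv_pow, ← div_eq_mul_inv, div_div, div_mul_eq_mul_div, le_div_iff₀ (by positivity)]
    linarith
  have hcoef : ∀ c : ℝ, 0 < c → 0 ≤ b / c * (κ⁻¹) ^ k := fun c hc => by positivity
  have haK : 0 < a * K := by positivity
  have htube : ∀ t ∈ Icc (0 : ℝ) 1, σ t ∈ S.tube S.Sminus ε₀ →
      ‖derivWithin σ (Icc 0 1) t‖ ≤ b / (a * K) * (κ⁻¹) ^ k *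
        ‖derivWithin (fun t => S.T^[i] (σ t)) (Icc 0 1) t‖ := by
    intro t ht htt
    have hd := dom_anti hni (hdom t ht)
    refine hbound _ haK t ht ?_
    have h1 := hB.noncontraction _ htt n (hp.trans_le hpn) hd (hball n hni hwn t ht) _
      (hσ.tangent t ht)
    have h2 := hB.le_norm _ (hball n hni hwn t ht) _ (D_mem_cone hphase hmap hcone hd (hcv t ht))
    rw [mul_assoc]
    exact (mul_le_mul_of_nonneg_left h1 hapos.le).trans h2
  have hlen0 : 0 ≤ S.imageLength i σ :=
    intervalIntegral.integral_nonneg zero_le_one fun _ _ => norm_nonneg _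
  refine ⟨?_, fun R hR hexpR => ?_⟩
  -- Non-contraction is only available in the tube of radius `ε₀`. Continuation backwards from the
  -- endpoint on `S⁻`: as long as the curve is in the tube, the length bound that follows keeps it
  -- there.
  · have hshort : ∀ t ∈ Icc (0 : ℝ) 1, ∫ u in t..1, ‖derivWithin σ (Icc 0 1) u‖ < ε₀ := by
      refine forall_Icc_of_forall_gt ?_ ?_
      · have hcont : ContinuousOn (fun t => ∫ u in t..1, ‖derivWithin σ (Icc 0 1) u‖)
            (Icc 0 1) := by
          have := intervalIntegral.continuousOn_primitive_interval_left (a := (0 : ℝ)) (b := 1)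
            (μ := volume) (f := fun u => ‖derivWithin σ (Icc 0 1) u‖) (by
              rw [uIcc_of_le zero_le_one]
              exact (continuousOn_norm_derivWithin hσ.contDiffOn).integrableOn_Icc)
          rwa [uIcc_of_le zero_le_one] at this
        simp only [not_lt]
        exact hcont.preimage_isClosed_of_isClosed isClosed_Icc isClosed_Ici
      · intro t ht hgt
        refine lt_of_le_of_lt (integral_norm_derivWithin_le hσ.contDiffOn hC ht.1 ht.2 le_rfl
          (hcoef _ haK) fun u hu => ?_) (lt_of_le_of_lt ?_ hε)
        · have hu' : u ∈ Icc (0 : ℝ) 1 := ⟨ht.1.trans hu.1.le, hu.2.le⟩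
          exact htube u hu' (hσ.mem_tube hmap hcone hy hu' (hgt u hu' hu.1).le)
        · refine mul_le_mul_of_nonneg_right ?_ hlen0
          refine mul_le_of_le_one_right (by positivity) ?_
          exact pow_le_one₀ (by positivity) (inv_le_one_of_one_le₀ hB.one_lt.le)
    refine integral_norm_derivWithin_le hσ.contDiffOn hC le_rfl zero_le_one le_rfl
      (hcoef _ haK) fun u hu => ?_
    have hu' := Ioo_subset_Icc_self hu
    exact htube u hu' (hσ.mem_tube hmap hcone hy hu' (hshort u hu').le)
  · refine integral_norm_derivWithin_le hσ.contDiffOn hC le_rfl zero_le_one le_rfl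
      (hcoef _ hR) fun u hu => ?_
    have hu' := Ioo_subset_Icc_self hu
    exact hbound R hR u hu' (hexpR u hu' n hpn (dom_anti hni (hdom u hu')) _ (hσ.tangent u hu'))

end IsExpansionBall

end SingularSystem

namespace SingularSystem

variable {ν : ℕ} {S : SingularSystem ν} {N : Sp ν → Sp ν → ℝ}

/-! ### Expansion near the singularity set -/

/-- The interior of the set of points where all iterates of order at least `m` expand the vectors
of the first nested cone by the factor `R`. -/
def expandingSet (S : SingularSystem ν) (N : Sp ν → Sp ν → ℝ) (R : ℝ) (m : ℕ) : Set (Sp ν) :=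
  interior {w | ∀ n ≥ m, w ∈ S.dom n → ∀ v ∈ S.coneOne w,
    R * ‖v‖ ≤ N (S.T^[n] w) (S.D n w v)}

lemma expandingSet_mono (R : ℝ) : Monotone (S.expandingSet N R) := fun _ _ h =>
  interior_mono fun _ hw n hn => hw n (h.trans hn)

/-- Expansion of cone vectors by an iterate is stable under perturbation of a point of `S⁻`. -/
lemma eventually_expanding (hphase : S.PhaseSpaceCondition) (hmap : S.MapCondition)
    (hcone : S.ConeCondition) (hnorm : S.IsIncreasingNorm N) {z : Sp ν} (hz : z ∈ S.Sminus)
    {m : ℕ} (hm : 0 < m) (hzm : z ∈ S.dom m) {R : ℝ} (hR : 0 < R)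
    (h : ∀ v ∈ S.coneOne z, 2 * R * ‖v‖ ≤ N (S.T^[m] z) (S.D m z v)) :
    ∀ᶠ w in 𝓝 z, w ∈ S.dom m → ∀ v ∈ S.coneOne w, R * ‖v‖ ≤ N (S.T^[m] w) (S.D m w v) := by
  by_contra hcon
  rw [not_eventually] at hcon
  obtain ⟨w, hwlim, hw⟩ := exists_seq_forall_of_frequently hcon
  push Not at hw
  choose hwd v hv hlt using hw
  have hcw : ∀ k, v k ∈ S.cone (w k) := fun k =>
    coneOne_subset_cone hmap hcone (mem_source_of_mem_dom hm (hwd k)) (hv k)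
  have hv0 : ∀ k, v k ≠ 0 := by
    intro k h0
    have h1 := hlt k
    have h2 := hnorm.nonneg (iterate_mem_M hmap (hwd k))
      (D_mem_cone hphase hmap hcone (hwd k) (hcw k))
    rw [h0, norm_zero, mul_zero] at h1
    rw [h0] at h2
    linarith
  have hu1 : ∀ k, ‖v k‖⁻¹ • v k ∈ Metric.sphere (0 : Sp ν) 1 := fun k => by
    rw [mem_sphere_zero_iff_norm]
    exact norm_smul_inv_norm (𝕜 := ℝ) (hv0 k)
  obtain ⟨u, hu, φ, hφ, hlim⟩ := (isCompact_sphere (0 : Sp ν) 1).tendsto_subseq hu1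
  have hwφ : Tendsto (fun k => w (φ k)) atTop (𝓝 z) := hwlim.comp hφ.tendsto_atTop
  have hpair : Tendsto (fun k => (w (φ k), ‖v (φ k)‖⁻¹ • v (φ k))) atTop (𝓝 (z, u)) :=
    hwφ.prodMk_nhds hlim
  -- Over `S⁻` the first nested cone is made of limits, so it contains the limit of the normalized
  -- bad vectors. There the factor `2 * R` contradicts a limiting value of at most `R`.
  have huz : u ∈ S.coneOne z := by
    refine Or.inr ⟨hz, ?_⟩
    refine isClosed_closure.mem_of_tendsto hpair (Eventually.of_forall fun k => ?_)
    exact mem_closure_of_mem_coneOne hmap (hwd _).1 (smul_mem_coneOne hmap hcone (hwd _).1 (hv _) _)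
  have huc : u ∈ S.cone z :=
    coneOne_subset_cone hmap hcone (mem_source_of_mem_dom hm hzm) huz
  have hcD : ContinuousAt (S.D m) z :=
    ((contDiffOn_iterate hphase hmap m).continuousOn_fderiv_of_isOpen
      (isOpen_dom hphase hmap m) le_rfl).continuousAt ((isOpen_dom hphase hmap m).mem_nhds hzm)
  have hcT : ContinuousAt S.T^[m] z :=
    (contDiffOn_iterate hphase hmap m).continuousOn.continuousAt
      ((isOpen_dom hphase hmap m).mem_nhds hzm)
  have hDlim : Tendsto (fun k => S.D m (w (φ k)) (‖v (φ k)‖⁻¹ • v (φ k))) atTop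
      (𝓝 (S.D m z u)) := 
    ((isBoundedBilinearMap_apply (𝕜 := ℝ) (E := Sp ν) (F := Sp ν)).continuous.tendsto
      (S.D m z, u)).comp ((hcD.tendsto.comp hwφ).prodMk_nhds hlim)
  have hTlim : Tendsto (fun k => S.T^[m] (w (φ k))) atTop (𝓝 (S.T^[m] z)) :=
    hcT.tendsto.comp hwφ
  have hNc := hnorm.continuousOn (S.T^[m] z, S.D m z u)
    ⟨iterate_mem_M hmap hzm, D_mem_cone hphase hmap hcone hzm huc⟩
  have hNlim : Tendsto (fun k => N (S.T^[m] (w (φ k))) (S.D m (w (φ k))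
      (‖v (φ k)‖⁻¹ • v (φ k)))) atTop (𝓝 (N (S.T^[m] z) (S.D m z u))) := by
    refine hNc.tendsto.comp (tendsto_nhdsWithin_iff.2 ⟨hTlim.prodMk_nhds hDlim,
      Eventually.of_forall fun k => ⟨iterate_mem_M hmap (hwd _), ?_⟩⟩)
    exact D_mem_cone hphase hmap hcone (hwd _) (hcone.smul_mem _ (hwd _).1 _ (hcw _) _)
  have hle : N (S.T^[m] z) (S.D m z u) ≤ R := by
    refine le_of_tendsto hNlim (Eventually.of_forall fun k => ?_)
    rw [map_smul, hnorm.smul _ (iterate_mem_M hmap (hwd _)) _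
      (D_mem_cone hphase hmap hcone (hwd _) (hcw _)), abs_of_nonneg (by positivity),
      inv_mul_le_iff₀ (norm_pos_iff.2 (hv0 _)), mul_comm _ R]
    exact (hlt _).le
  have h1 := h u huz
  rw [mem_sphere_zero_iff_norm.1 hu] at h1
  linarith

lemma exists_mem_expandingSet (hphase : S.PhaseSpaceCondition) (hmap : S.MapCondition)
    (hcone : S.ConeCondition) (hnorm : S.IsIncreasingNorm N) {z : Sp ν} (hz : z ∈ S.Sminus)
    (hdom : ∀ n, z ∈ S.dom n)
    (hexp : ∀ R : ℝ, ∀ᶠ n in atTop, ∀ v ∈ S.coneOne z,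
      R * N z v ≤ N (S.T^[n] z) (S.D n z v)) {R : ℝ} (hR : 0 < R) :
    ∃ m, z ∈ S.expandingSet N R m := by
  obtain ⟨a, ha, b, -, hab⟩ := hnorm.locally_equivalent z (hdom 0).1
  -- Division by `a` converts from the increasing norm at `z` to the Euclidean one. A single order
  -- `m` suffices, as the norm does not decrease later.
  obtain ⟨m, hm, hm0⟩ := ((hexp (2 * R / a)).and (eventually_gt_atTop 0)).exists
  have hsrc := mem_source_of_mem_dom hm0 (hdom m)
  have h := eventually_expanding hphase hmap hcone hnorm hz hm0 (hdom m) hR fun v hv => by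
    have h1 := (hab.self_of_nhds v (coneOne_subset_cone hmap hcone hsrc hv)).1
    refine le_trans ?_ (hm v hv)
    rw [div_mul_eq_mul_div, le_div_iff₀ ha]
    nlinarith
  refine ⟨m, mem_interior_iff_mem_nhds.2 ?_⟩
  filter_upwards [h] with w hw n hn hwn v hv
  have hwm := dom_anti hn hwn
  exact (hw hwm v hv).trans (hnorm.monotone_orbit hphase hmap hcone hn hwn
    (coneOne_subset_cone hmap hcone (mem_source_of_mem_dom hm0 hwm) hv))

/-- Outside a closed set of small measure `π`, the points of `S⁻` have a ball in which the iterates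
of large order expand. -/
lemma exists_closed_ball_subset_expandingSet (hphase : S.PhaseSpaceCondition)
    (hmap : S.MapCondition) (hcone : S.ConeCondition) (hnorm : S.IsIncreasingNorm N)
    {π : Measure (Sp ν)} (htube : S.TubeCondition π) (hansatz : S.SinaiChernovAnsatz π N) {R h : ℝ}
    (hR : 0 < R) (hh : 0 < h) :
    ∃ (m : ℕ) (F : Set (Sp ν)) (ρ : ℝ), IsClosed F ∧ 0 < ρ ∧ π F ≤ ENNReal.ofReal h ∧
      ∀ y ∉ F, Metric.ball y ρ ⊆ S.expandingSet N R m := by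
  have : IsFiniteMeasure π := ⟨htube.finite⟩
  have hopen : ∀ m, IsOpen (S.expandingSet N R m) := fun m => isOpen_interior
  have hpos : 0 < ENNReal.ofReal h := ENNReal.ofReal_pos.2 hh
  have hnull : π (⋂ m, (S.expandingSet N R m)ᶜ) = 0 := by
    rw [← compl_iUnion, ← mem_ae_iff]
    have hS : ∀ᵐ z ∂π, z ∈ S.Sminus := htube.supported
    filter_upwards [hS, hansatz] with z hz hz'
    obtain ⟨h1, h2⟩ := hz' hz
    exact mem_iUnion.2 (exists_mem_expandingSet hphase hmap hcone hnorm hz h1 h2 hR)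
  have hlim := tendsto_measure_iInter_atTop (μ := π)
    (fun m => (hopen m).measurableSet.compl.nullMeasurableSet)
    (fun _ _ hmn => compl_subset_compl.2 (expandingSet_mono (S := S) (N := N) R hmn))
    ⟨0, measure_ne_top π _⟩
  rw [hnull] at hlim
  obtain ⟨m, hm⟩ := (hlim.eventually (gt_mem_nhds hpos)).exists
  have hcl : IsClosed (S.expandingSet N R m)ᶜ := (hopen m).isClosed_compl
  -- The set `F` is a closed thickening of the complement of the expanding set: still of small
  -- measure, and its complement has a uniform margin `ρ`.
  have hthick := tendsto_measure_cthickening_of_isClosed (μ := π)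
    ⟨1, one_pos, measure_ne_top π _⟩ hcl
  have hev := (hthick.mono_left (nhdsWithin_le_nhds (s := Ioi 0))).eventually (gt_mem_nhds hm)
  obtain ⟨ρ, hρ, hρ0⟩ := (hev.and self_mem_nhdsWithin).exists
  refine ⟨m, _, ρ, Metric.isClosed_cthickening, hρ0, hρ.le, fun y hy x hx => ?_⟩
  by_contra hxm
  refine hy (Metric.mem_cthickening_of_dist_le y x ρ _ hxm ?_)
  rw [dist_comm]
  exact (Metric.mem_ball.1 hx).le

/-! ### Invariance of the symplectic volume -/

/-- The symplectic form at a point, as a bilinear form. -/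
noncomputable def formBilin (S : SingularSystem ν) (z : Sp ν) : LinearMap.BilinForm ℝ (Sp ν) :=
  LinearMap.mk₂ ℝ (fun u v => S.ω z ![u, v])
    (fun u u' v => (S.ω z).toAlternatingMap.map_vecCons_add ![v] u u')
    (fun c u v => (S.ω z).toAlternatingMap.map_vecCons_smul ![v] c u)
    (fun u v v' => by
      have h : ∀ x : Sp ν, ![u, x] = Function.update ![u, 0] 1 x := fun x => by
        ext i; fin_cases i <;> rfl
      rw [h, h v, h v', ContinuousAlternatingMap.map_update_add])
    (fun c u v => by
      have h : ∀ x : Sp ν, ![u, x] = Function.update ![u, 0] 1 x := fun x => by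
        ext i; fin_cases i <;> rfl
      rw [h, h v, ContinuousAlternatingMap.map_update_smul])

/-- Invariance of the form reads `Aᵀ Ω' A = Ω` in matrices; the square roots of the determinants
give the claim. -/
lemma abs_det_mul_volumeDensity (hmap : S.MapCondition) {z : Sp ν} (hz : z ∈ S.T.source) :
    |(S.D 1 z).det| * S.volumeDensity (S.T z) = S.volumeDensity z := by
  let b := (EuclideanSpace.basisFun (Fin (2 * ν)) ℝ).toBasis
  have hden : ∀ z, S.volumeDensity z =
      Real.sqrt |(LinearMap.BilinForm.toMatrix b (S.formBilin z)).det| := fun z => by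
    unfold volumeDensity
    congr 3
  have hcomp : (S.formBilin (S.T z)).comp (S.D 1 z : Sp ν →ₗ[ℝ] Sp ν)
      (S.D 1 z : Sp ν →ₗ[ℝ] Sp ν) = S.formBilin z := by
    ext u v
    exact hmap.symplectic z hz _ _
  rw [hden, hden, ← hcomp, LinearMap.BilinForm.toMatrix_comp b b, Matrix.det_mul, Matrix.det_mul,
    Matrix.det_transpose, LinearMap.det_toMatrix]
  have h : LinearMap.det (S.D 1 z : Sp ν →ₗ[ℝ] Sp ν) = (S.D 1 z).det := rfl
  rw [h, mul_right_comm, abs_mul, Real.sqrt_mul (abs_nonneg _), abs_mul_self,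
    Real.sqrt_mul_self_eq_abs]

lemma measure_eq_setLIntegral (hphase : S.PhaseSpaceCondition) {A : Set (Sp ν)} (hA : A ⊆ S.M) :
    S.μ A = ∫⁻ z in A, ENNReal.ofReal (S.volumeDensity z) := by
  rw [μ, withDensity_apply', Measure.restrict_restrict' hphase.isOpen.measurableSet,
    inter_eq_self_of_subset_left hA]

/-- Change of variables on a measurable hull gives the inequality for outer measures, with no
measurability of `A`. -/
lemma measure_image_le (hphase : S.PhaseSpaceCondition) (hmap : S.MapCondition) {A : Set (Sp ν)}
    (hA : A ⊆ S.T.source) : S.μ (S.T '' A) ≤ S.μ A := by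
  set B := toMeasurable S.μ A ∩ S.T.source
  have hB : MeasurableSet B :=
    (measurableSet_toMeasurable _ _).inter S.T.open_source.measurableSet
  have hAB : A ⊆ B := subset_inter (subset_toMeasurable _ _) hA
  have hBs : B ⊆ S.T.source := inter_subset_right
  calc S.μ (S.T '' A) ≤ S.μ (S.T '' B) := measure_mono (image_mono hAB)
    _ = ∫⁻ z in S.T '' B, ENNReal.ofReal (S.volumeDensity z) :=
        measure_eq_setLIntegral hphase (image_subset_iff.2 fun z hz =>
          target_subset hmap (S.T.map_source (hBs hz)))
    _ = ∫⁻ z in B, ENNReal.ofReal |(S.D 1 z).det| * ENNReal.ofReal (S.volumeDensity (S.T z)) :=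
        lintegral_image_eq_lintegral_abs_det_fderiv_mul volume hB
          (fun z hz => (hasFDerivAt_iterate hphase hmap
            (mem_dom_one hmap (hBs hz))).hasFDerivWithinAt) (S.T.injOn.mono hBs) _
    _ = ∫⁻ z in B, ENNReal.ofReal (S.volumeDensity z) := by
        refine setLIntegral_congr_fun hB fun z hz => ?_
        rw [← ENNReal.ofReal_mul (abs_nonneg _), abs_det_mul_volumeDensity hmap (hBs hz)]
    _ = S.μ B := (measure_eq_setLIntegral hphase (hBs.trans (source_subset hmap))).symm
    _ ≤ S.μ (toMeasurable S.μ A) := measure_mono inter_subset_left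
    _ = S.μ A := measure_toMeasurable _

lemma measure_iterate_image_le (hphase : S.PhaseSpaceCondition) (hmap : S.MapCondition) {n : ℕ}
    {A : Set (Sp ν)} (hA : A ⊆ S.dom n) : S.μ (S.T^[n] '' A) ≤ S.μ A := by
  induction n with
  | zero => simp
  | succ n ih =>
    rw [Function.iterate_succ', image_comp]
    exact (measure_image_le hphase hmap (image_subset_iff.2 fun z hz =>
      (hA hz).2 n n.lt_succ_self)).trans (ih (hA.trans (dom_anti n.le_succ)))

/-! ### Counting visits -/

/-- The points whose orbit is in `U` at time `n`, after `k` visits at times in `[p, n)`. -/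
def visitSet (S : SingularSystem ν) (U : Set (Sp ν)) (p k n : ℕ) : Set (Sp ν) :=
  {w ∈ S.dom n | S.T^[n] w ∈ U ∧ S.visits U p n w = k}

lemma measurableSet_visitSet (hphase : S.PhaseSpaceCondition) (hmap : S.MapCondition)
    {U : Set (Sp ν)} (hU : IsOpen U) (p k n : ℕ) : MeasurableSet (S.visitSet U p k n) := by
  classical
  have hD : ∀ j, MeasurableSet (S.dom j ∩ S.T^[j] ⁻¹' U) := fun j =>
    ((contDiffOn_iterate hphase hmap j).continuousOn.isOpen_inter_preimage
      (isOpen_dom hphase hmap j) hU).measurableSet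
  have hf : Measurable fun w => ∑ j ∈ Finset.Ico p n,
      (S.dom j ∩ S.T^[j] ⁻¹' U).indicator (fun _ => (1 : ℕ)) w :=
    Finset.measurable_sum _ fun j _ => measurable_const.indicator (hD j)
  have heq : S.visitSet U p k n = (S.dom n ∩ S.T^[n] ⁻¹' U) ∩
      {w | ∑ j ∈ Finset.Ico p n,
        (S.dom j ∩ S.T^[j] ⁻¹' U).indicator (fun _ => (1 : ℕ)) w = k} := by
    ext w
    have hsum : w ∈ S.dom n → S.visits U p n w = ∑ j ∈ Finset.Ico p n,
        (S.dom j ∩ S.T^[j] ⁻¹' U).indicator (fun _ => (1 : ℕ)) w := fun hw => by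
      rw [visits, Finset.card_filter]
      refine Finset.sum_congr rfl fun j hj => ?_
      have hwj := dom_anti (Finset.mem_Ico.1 hj).2.le hw
      simp [indicator, hwj]
    constructor
    · exact fun ⟨h1, h2, h3⟩ => ⟨⟨h1, h2⟩, (hsum h1).symm.trans h3⟩
    · exact fun ⟨⟨h1, h2⟩, h3⟩ => ⟨h1, h2, (hsum h1).trans h3⟩
  rw [heq]
  exact (hD n).inter (hf (measurableSet_singleton k))

/-- Membership fixes the time as that of the `(k+1)`-st visit from time `p` on, and an orbit has at
most one such time. -/
lemma pairwise_disjoint_visitSet (U : Set (Sp ν)) (p k : ℕ) :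
    Pairwise (Function.onFun Disjoint fun n => S.visitSet U p k (p + n)) := by
  classical
  have key : ∀ m n w, m < n → w ∈ S.visitSet U p k (p + m) → w ∉ S.visitSet U p k (p + n) := by
    rintro m n w hmn ⟨-, h1, h2⟩ ⟨-, -, h3⟩
    have hlt : S.visits U p (p + m) w < S.visits U p (p + n) w := by
      refine Finset.card_lt_card (Finset.ssubset_iff_of_subset (fun j hj => ?_) |>.2
        ⟨p + m, ?_, ?_⟩)
      · rw [Finset.mem_filter, Finset.mem_Ico] at hj ⊢
        exact ⟨⟨hj.1.1, by omega⟩, hj.2⟩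
      · rw [Finset.mem_filter, Finset.mem_Ico]
        exact ⟨⟨by omega, by omega⟩, h1⟩
      · simp
    omega
  intro m n hmn
  refine disjoint_left.2 fun w hm hn => ?_
  rcases lt_or_gt_of_ne hmn with h | h
  · exact key m n w h hm hn
  · exact key n m w h hn hm

/-- The contribution of the time `p + n` to the measure of the points that are images of points of
`A k` at their `k`-th visit. -/
noncomputable def visitMass (S : SingularSystem ν) (U : Set (Sp ν)) (p : ℕ) (A : ℕ → Set (Sp ν))
    (n : ℕ) : ℝ≥0∞ :=
  ∑' k, S.μ (toMeasurable S.μ (A k) ∩ S.visitSet U p k (p + n))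

/-- With the order of summation exchanged, the pieces of the hull of `A k` are disjoint over `n`, so
they add up to at most its measure. -/
lemma tsum_visitMass_le (hphase : S.PhaseSpaceCondition) (hmap : S.MapCondition)
    {U : Set (Sp ν)} (hU : IsOpen U) (p : ℕ) (A : ℕ → Set (Sp ν)) :
    ∑' n, S.visitMass U p A n ≤ ∑' k, S.μ (A k) := by
  unfold visitMass
  rw [ENNReal.tsum_comm]
  refine ENNReal.tsum_le_tsum fun k => ?_
  rw [← measure_iUnion (fun m n hmn => (pairwise_disjoint_visitSet U p k hmn).mono
    inter_subset_right inter_subset_right) fun n => (measurableSet_toMeasurable _ _).inter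
      (measurableSet_visitSet hphase hmap hU p k _), ← measure_toMeasurable (A k)]
  exact measure_mono (iUnion_subset fun n => inter_subset_left)

/-- The shift `m` leaves only a tail of the series when the images have high order. -/
lemma measure_le_tsum_visitMass (hphase : S.PhaseSpaceCondition) (hmap : S.MapCondition)
    {U : Set (Sp ν)} {p m : ℕ} {A : ℕ → Set (Sp ν)} {Z : Set (Sp ν)}
    (hZ : ∀ z ∈ Z, ∃ n k w, w ∈ A k ∧ w ∈ S.visitSet U p k (p + (n + m)) ∧
      S.T^[p + (n + m)] w = z) :
    S.μ Z ≤ ∑' n, S.visitMass U p A (n + m) := by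
  have hsub : Z ⊆ ⋃ n, ⋃ k, S.T^[p + (n + m)] '' (A k ∩ S.visitSet U p k (p + (n + m))) := by
    intro z hz
    obtain ⟨n, k, w, h1, h2, h3⟩ := hZ z hz
    exact mem_iUnion₂.2 ⟨n, k, w, ⟨h1, h2⟩, h3⟩
  refine (measure_mono hsub).trans ((measure_iUnion_le _).trans (ENNReal.tsum_le_tsum fun n =>
    (measure_iUnion_le _).trans (ENNReal.tsum_le_tsum fun k => ?_)))
  exact (measure_iterate_image_le hphase hmap fun w hw => hw.2.1).trans
    (measure_mono (inter_subset_inter_left _ (subset_toMeasurable _ _)))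

end SingularSystem

lemma eventually_const_mul_lt {x y : ℝ} (hx : 0 < x) (hy : 0 < y) :
    ∀ᶠ t in 𝓝[>] (0 : ℝ), x * t < y := by
  filter_upwards [Ioo_mem_nhdsGT (div_pos hy hx)] with t ht
  rw [mul_comm]
  exact (lt_div_iff₀ hx).1 ht.2

lemma tsum_ofReal_mul_pow {c q : ℝ} (hc : 0 ≤ c) (hq0 : 0 ≤ q) (hq1 : q < 1) :
    ∑' k : ℕ, ENNReal.ofReal (c * q ^ k) = ENNReal.ofReal (c / (1 - q)) := by
  rw [← ENNReal.ofReal_tsum_of_nonneg (fun k => by positivity)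
    ((summable_geometric_of_lt_one hq0 hq1).mul_left c), tsum_mul_left,
    tsum_geometric_of_lt_one hq0 hq1, div_eq_mul_inv]

/-! ### Measure of the cut sets, for fixed and for small `δ`. -/

namespace SingularSystem

variable {ν : ℕ} {S : SingularSystem ν} {N : Sp ν → Sp ν → ℝ}

/-- A cut of a local unstable manifold near `z₀` comes from an unstable curve that ends in `S⁻`
and whose length is exponentially small in the number of visits. -/
lemma IsExpansionBall.exists_unstableCurve_of_cut {z₀ : Sp ν} {r a b κ K ε₀ : ℝ}
    (hB : S.IsExpansionBall N z₀ r a b κ K ε₀) (hphase : S.PhaseSpaceCondition)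
    (hmap : S.MapCondition) (hcone : S.ConeCondition) (hnorm : S.IsIncreasingNorm N) {δ : ℝ}
    (hδr : δ ≤ r) (hδa : b / a * δ < r) (hδK : b / (a * K) * δ < ε₀) {p m : ℕ} (hp : 0 < p)
    (hpm : p ≤ m) {z : Sp ν} (hz : z ∈ Metric.ball z₀ r) {W : Set (Sp ν)}
    (hW : S.IsLocalUnstableManifold z W)
    (hcut : radiusCutBy z W (⋃ i > m, S.imageSminus i) < ENNReal.ofReal δ) :
    ∃ n ≥ m, ∃ k w y σ, w ∈ S.visitSet (Metric.ball z₀ r) p k n ∧ S.T^[n] w = z ∧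
      y ∈ S.Sminus ∧ S.IsUnstableCurve σ w y ∧
      ∫ t in (0 : ℝ)..1, ‖derivWithin σ (Icc 0 1) t‖ ≤ b / (a * K) * δ * (κ⁻¹) ^ k ∧
      ∀ R > 0, (∀ t ∈ Icc (0 : ℝ) 1, σ t ∈ S.expandingSet N R p) →
        ∫ t in (0 : ℝ)..1, ‖derivWithin σ (Icc 0 1) t‖ ≤ b / R * δ * (κ⁻¹) ^ k := by
  have hapos := hB.a_pos
  have hbpos := hB.b_pos
  have hKpos := hB.K_pos
  have hκpos : 0 < κ := one_pos.trans hB.one_lt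
  obtain ⟨γ, hγ⟩ := iInf_lt_iff.1 hcut
  obtain ⟨⟨hC, h0, hγW, h1⟩, hlt⟩ := iInf_lt_iff.1 hγ
  obtain ⟨i, him, y, ⟨hyS, hyd⟩, hy⟩ := mem_iUnion₂.1 h1.2
  obtain ⟨hσ, hfwd⟩ := hW.isUnstableCurve hphase hmap hC h0 hγW hyS hyd hy.symm
  set σ : ℝ → Sp ν := fun t => S.T.symm^[i] (γ t) with hσdef
  have hw : S.T^[i] (S.T.symm^[i] z) = z := by
    have := (hfwd 0 (by simp)).2
    rwa [h0] at this
  have hwd : S.T.symm^[i] z ∈ S.dom i := by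
    have := (hfwd 0 (by simp)).1
    rwa [h0] at this
  have hlen : S.imageLength i σ = ∫ t in (0 : ℝ)..1, ‖derivWithin γ (Icc 0 1) t‖ := by
    refine intervalIntegral.integral_congr fun t ht => ?_
    rw [uIcc_of_le zero_le_one] at ht
    rw [derivWithin_congr (fun s hs => (hfwd s hs).2) (hfwd t ht).2]
  have hδ : S.imageLength i σ < δ := by
    rw [curveLength_eq_ofReal_integral hC, ← hlen] at hlt
    exact (ENNReal.ofReal_lt_ofReal_iff'.1 hlt).1
  have hmono : ∀ c : ℝ, 0 ≤ c → c * S.imageLength i σ ≤ c * δ := fun c hc =>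
    mul_le_mul_of_nonneg_left hδ.le hc
  obtain ⟨hb1, hb2⟩ := hB.integral_norm_derivWithin_le_visits hphase hmap hcone hnorm hp
    (hpm.trans him.le) hσ hyS (fun t ht => (hfwd t ht).1) (by rw [hw]; exact hz)
    (hδ.trans_le hδr) ((hmono _ (by positivity)).trans_lt hδa)
    ((hmono _ (by positivity)).trans_lt hδK)
  refine ⟨i, him.le, _, _, y, σ, ⟨hwd, by rw [hw]; exact hz, rfl⟩, hw, hyS, hσ, ?_, ?_⟩
  · rw [mul_right_comm]
    exact hb1.trans (hmono _ (by positivity))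
  · intro R hR hexp
    rw [mul_right_comm]
    exact (hb2 R hR fun t ht => interior_subset (hexp t ht)).trans (hmono _ (by positivity))

/-- The total measure of tubes whose radii form a geometric sequence. -/
lemma TubeCondition.tsum_tube_le {π : Measure (Sp ν)} (htube : S.TubeCondition π)
    {F : Set (Sp ν)} (hF : IsClosed F) {h : ℝ} (hh : 0 < h) :
    ∃ ε₁ > 0, ∀ c q : ℝ, 0 < c → c < ε₁ → 0 < q → q < 1 →
      ∑' k : ℕ, S.μ (S.tube (S.Sminus ∩ F) (c * q ^ k)) ≤
        (π F + ENNReal.ofReal h) * ENNReal.ofReal (c / (1 - q)) := by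
  obtain ⟨ε₁, hε₁, hsub⟩ := mem_nhdsGT_iff_exists_Ioo_subset.1 (htube.tube_le F hF h hh)
  refine ⟨ε₁, hε₁, fun c q hc hcε hq0 hq1 => ?_⟩
  rw [← tsum_ofReal_mul_pow hc.le hq0.le hq1, ← ENNReal.tsum_mul_left]
  refine ENNReal.tsum_le_tsum fun k => ?_
  have hle : c * q ^ k ≤ c := mul_le_of_le_one_right hc.le (pow_le_one₀ hq0.le hq1.le)
  refine (hsub ⟨by positivity, hle.trans_lt hcε⟩).trans ?_
  gcongr
  exact inter_subset_right

/-- The points near `z₀` some local unstable manifold of which has radius less than `δ` because it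
is cut by the images of `S⁻` of order greater than `m`. -/
def cutSet (S : SingularSystem ν) (U : Set (Sp ν)) (m : ℕ) (δ : ℝ) : Set (Sp ν) :=
  {z ∈ U | ∃ W, S.IsLocalUnstableManifold z W ∧
    radiusCutBy z W (⋃ i > m, S.imageSminus i) < ENNReal.ofReal δ}

lemma cutSet_subset (U : Set (Sp ν)) {m n : ℕ} (hmn : m ≤ n) {δ δ' : ℝ} (hδ : δ ≤ δ') :
    S.cutSet U n δ ⊆ S.cutSet U m δ' := by
  rintro z ⟨hz, W, hW, hcut⟩
  refine ⟨hz, W, hW, lt_of_le_of_lt ?_ (hcut.trans_le (ENNReal.ofReal_le_ofReal hδ))⟩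
  refine le_iInf₂ fun γ hγ => iInf₂_le γ ⟨hγ.1, hγ.2.1, hγ.2.2.1, hγ.2.2.2.1, ?_⟩
  obtain ⟨i, hi, hmem⟩ := mem_iUnion₂.1 hγ.2.2.2.2
  exact mem_iUnion₂.2 ⟨i, lt_of_le_of_lt hmn hi, hmem⟩

namespace IsExpansionBall

variable {z₀ : Sp ν} {r a b κ K ε₀ : ℝ}

/-- For a fixed `δ`, the measure of the cut set tends to zero with the order of the images. -/
lemma exists_measure_cutSet_le (hB : S.IsExpansionBall N z₀ r a b κ K ε₀)
    (hphase : S.PhaseSpaceCondition)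
    (hmap : S.MapCondition) (hcone : S.ConeCondition) (hnorm : S.IsIncreasingNorm N) {δ : ℝ}
    (hδr : δ ≤ r) (hδa : b / a * δ < r) (hδK : b / (a * K) * δ < ε₀)
    (hfin : ∑' k : ℕ, S.μ (S.tube S.Sminus (b / (a * K) * δ * (κ⁻¹) ^ k)) ≠ ∞) {e : ℝ≥0∞}
    (he : 0 < e) : ∃ m, S.μ (S.cutSet (Metric.ball z₀ r) m δ) ≤ e := by
  -- The family of sets is the tubes of radius `b / (a * K) * δ * κ⁻¹ ^ k`, read off from `hfin`.
  have hsum := ne_top_of_le_ne_top hfin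
    (tsum_visitMass_le hphase hmap (Metric.isOpen_ball (x := z₀) (ε := r)) 1 _)
  obtain ⟨m, hm⟩ := ((ENNReal.tendsto_sum_nat_add _ hsum).eventually (gt_mem_nhds he)).exists
  refine ⟨1 + m, (measure_le_tsum_visitMass hphase hmap ?_).trans hm.le⟩
  rintro z ⟨hz, W, hW, hcut⟩
  obtain ⟨n, hn, k, w, y, σ, h1, h2, h3, h4, h5, -⟩ :=
    hB.exists_unstableCurve_of_cut hphase hmap hcone hnorm hδr hδa hδK one_pos (by omega) hz hW hcut
  obtain ⟨l, rfl⟩ := Nat.exists_eq_add_of_le hn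
  have hl : 1 + m + l = 1 + (l + m) := by ring
  rw [hl] at h1 h2
  refine ⟨l, k, w, ?_, h1, h2⟩
  rw [← h4.start]
  exact h4.mem_tube hmap hcone h3 (by simp) h5

/-- For small `δ`, the measure of the cut set is at most `η δ`. -/
lemma exists_measure_cutSet_le_mul (hB : S.IsExpansionBall N z₀ r a b κ K ε₀)
    (hphase : S.PhaseSpaceCondition) (hmap : S.MapCondition) (hcone : S.ConeCondition)
    (hnorm : S.IsIncreasingNorm N) {π : Measure (Sp ν)} (htube : S.TubeCondition π)
    (hansatz : S.SinaiChernovAnsatz π N) {δ₀ : ℝ} (hδ₀ : 0 < δ₀)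
    (hδr : δ₀ ≤ r) (hδa : b / a * δ₀ < r) (hδK : b / (a * K) * δ₀ < ε₀) {η : ℝ} (hη : 0 < η) :
    ∃ m, ∃ δ₁ > 0, ∀ δ, 0 < δ → δ ≤ δ₁ →
      S.μ (S.cutSet (Metric.ball z₀ r) m δ) ≤ ENNReal.ofReal (η * δ) := by
  have hapos := hB.a_pos
  have hbpos := hB.b_pos
  have hKpos := hB.K_pos
  have hq0 : 0 < κ⁻¹ := inv_pos.2 (one_pos.trans hB.one_lt)
  have hq1 : κ⁻¹ < 1 := inv_lt_one_of_one_lt₀ hB.one_lt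
  set q := κ⁻¹
  have hq : 0 < 1 - q := sub_pos.2 hq1
  set c := b / (a * K)
  have hc : 0 < c := by positivity
  set Q := (π univ).toReal
  have hQ : 0 ≤ Q := ENNReal.toReal_nonneg
  have hQπ : π univ = ENNReal.ofReal Q := (ENNReal.ofReal_toReal htube.finite.ne).symm
  -- Chosen so that `2h · cδ / (1 - q) = ηδ / 2`, as `π F ≤ h` and the tube condition costs another
  -- `h`. Likewise `R` is chosen so that `(Q + 1)(b / R)δ / (1 - q) = ηδ / 2`.
  set h := η * (1 - q) / (4 * c)
  have hh : 0 < h := by positivity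
  set R := 2 * (Q + 1) * b / (η * (1 - q))
  have hR : 0 < R := by positivity
  obtain ⟨m, F, ρ, hF, hρ, hπF, hball⟩ := exists_closed_ball_subset_expandingSet hphase hmap hcone
    hnorm htube hansatz hR hh
  obtain ⟨ε₁, hε₁, hsum₁⟩ := htube.tsum_tube_le hF hh
  obtain ⟨ε₂, hε₂, hsum₂⟩ := htube.tsum_tube_le isClosed_univ one_pos
  set d := b / R
  have hd : 0 < d := by positivity
  obtain ⟨δ₁, hδ₁, hlt⟩ : ∃ δ₁ > 0, δ₁ ≤ δ₀ ∧ c * δ₁ < ε₁ ∧ c * δ₁ < ρ ∧ d * δ₁ < ε₂ := by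
    obtain ⟨t, h1, h2, h3, h4, h5⟩ := ((eventually_const_mul_lt one_pos hδ₀).and ((eventually_const_mul_lt hc hε₁).and
      ((eventually_const_mul_lt hc hρ).and ((eventually_const_mul_lt hd hε₂).and self_mem_nhdsWithin)))).exists
    exact ⟨t, h5, by linarith, h2, h3, h4⟩
  obtain ⟨hl0, hl1, hl2, hl3⟩ := hlt
  -- The order `m + 1` keeps the starting time of the count positive.
  refine ⟨m + 1, δ₁, hδ₁, fun δ hδ hδle => ?_⟩
  have hδδ₀ := hδle.trans hl0
  have hcδ : c * δ ≤ c * δ₁ := by gcongr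
  have hdδ : d * δ ≤ d * δ₁ := by gcongr
  -- The whole series is used here (shift `0`): smallness comes from the tubes and not from a tail.
  have hcover : ∀ z ∈ S.cutSet (Metric.ball z₀ r) (m + 1) δ, ∃ n k w,
      w ∈ S.tube (S.Sminus ∩ F) (c * δ * q ^ k) ∪ S.tube (S.Sminus ∩ univ) (d * δ * q ^ k) ∧
      w ∈ S.visitSet (Metric.ball z₀ r) (m + 1) k (m + 1 + (n + 0)) ∧
      S.T^[m + 1 + (n + 0)] w = z := by
    rintro z ⟨hz, W, hW, hcut⟩
    obtain ⟨n, hn, k, w, y, σ, h1, h2, h3, h4, h5, h6⟩ :=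
      hB.exists_unstableCurve_of_cut hphase hmap hcone hnorm (hδδ₀.trans hδr)
        (lt_of_le_of_lt (by gcongr) hδa) (lt_of_le_of_lt (by gcongr) hδK) m.succ_pos le_rfl
        hz hW hcut
    obtain ⟨l, rfl⟩ := Nat.exists_eq_add_of_le hn
    refine ⟨l, k, w, ?_, h1, h2⟩
    rw [← h4.start]
    by_cases hy : y ∈ F
    · exact Or.inl (h4.mem_tube hmap hcone (mem_inter h3 hy) (by simp) h5)
    · refine Or.inr (h4.mem_tube hmap hcone (mem_inter h3 (mem_univ _)) (by simp)
        (h6 R hR fun t ht => ?_))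
      -- The first length bound and `c * δ₁ < ρ` keep the whole curve in the expansion ball of its
      -- endpoint; this gives access to the second, sharper bound.
      refine expandingSet_mono R m.le_succ (hball y hy ?_)
      rw [Metric.mem_ball, ← h4.finish]
      refine lt_of_le_of_lt (dist_le_integral_norm_derivWithin h4.contDiffOn ht.1 ht.2 le_rfl) ?_
      have h7 := integral_norm_derivWithin_le h4.contDiffOn h4.contDiffOn ht.1 ht.2 le_rfl
        zero_le_one (fun u _ => (one_mul _).ge)
      have h8 : c * δ * q ^ k ≤ c * δ :=
        mul_le_of_le_one_right (by positivity) (pow_le_one₀ hq0.le hq1.le)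
      linarith
  have hmeas := (measure_le_tsum_visitMass hphase hmap hcover).trans
    (tsum_visitMass_le hphase hmap Metric.isOpen_ball (m + 1) _)
  refine hmeas.trans ((ENNReal.tsum_le_tsum fun k => measure_union_le _ _).trans ?_)
  rw [ENNReal.tsum_add]
  have hb1 : (π F + ENNReal.ofReal h) * ENNReal.ofReal (c * δ / (1 - q)) ≤
      ENNReal.ofReal (η * δ / 2) := by
    calc _ ≤ (ENNReal.ofReal h + ENNReal.ofReal h) * ENNReal.ofReal (c * δ / (1 - q)) := by gcongr
      _ = ENNReal.ofReal (η * δ / 2) := by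
        rw [← ENNReal.ofReal_add hh.le hh.le, ← ENNReal.ofReal_mul (by positivity)]
        congr 1
        simp only [h]
        field_simp
        ring
  have hb2 : (π univ + ENNReal.ofReal 1) * ENNReal.ofReal (d * δ / (1 - q)) =
      ENNReal.ofReal (η * δ / 2) := by
    rw [hQπ, ← ENNReal.ofReal_add hQ zero_le_one, ← ENNReal.ofReal_mul (by positivity)]
    congr 1
    simp only [d, R]
    field_simp
  calc _ ≤ ENNReal.ofReal (η * δ / 2) + ENNReal.ofReal (η * δ / 2) := by
        gcongr
        · exact (hsum₁ (c * δ) q (by positivity) (hcδ.trans_lt hl1) hq0 hq1).trans hb1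
        · exact (hsum₂ (d * δ) q (by positivity) (hdδ.trans_lt hl3) hq0 hq1).trans hb2.le
    _ = ENNReal.ofReal (η * δ) := by
        rw [← ENNReal.ofReal_add (by positivity) (by positivity), add_halves]

end IsExpansionBall

end SingularSystem

theorem mainTheorem7 {ν : ℕ} (S : SingularSystem ν) (π : Measure (Sp ν)) (N : Sp ν → Sp ν → ℝ)
    (hphase : S.PhaseSpaceCondition) (hmap : S.MapCondition) (hcone : S.ConeCondition)
    (hreg : S.RegularityCondition) (htube : S.TubeCondition π) (halign : S.AlignmentCondition)
    (hnc : S.NonContractionCondition) (hnorm : S.IsIncreasingNorm N)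
    (hansatz : S.SinaiChernovAnsatz π N) :
    ∀ z₀ ∈ S.M, ∃ U ∈ 𝓝 z₀, ∃ δ₀ : ℝ, 0 < δ₀ ∧ ∀ η : ℝ, 0 < η → ∃ m : ℕ,
      ∀ δ : ℝ, 0 < δ → δ ≤ δ₀ →
        S.μ {z ∈ U | ∃ W, S.IsLocalUnstableManifold z W ∧
          radiusCutBy z W (⋃ i > m, S.imageSminus i) < ENNReal.ofReal δ}
        ≤ ENNReal.ofReal (η * δ) := by
  intro z₀ hz₀
  obtain ⟨r, a, b, κ, K, ε₀, hB⟩ := S.exists_isExpansionBall hphase hnc hnorm hz₀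
  have hapos := hB.a_pos
  have hbpos := hB.b_pos
  have hKpos := hB.K_pos
  obtain ⟨ε₁, hε₁, hsum⟩ := htube.tsum_tube_le isClosed_univ one_pos
  have hc : 0 < b / (a * K) := by positivity
  obtain ⟨δ₀, h1, h2, h3, h4, hδ₀⟩ := ((eventually_const_mul_lt one_pos hB.r_pos).and
    ((eventually_const_mul_lt (div_pos hbpos hapos) hB.r_pos).and
      ((eventually_const_mul_lt hc hB.ε₀_pos).and
        ((eventually_const_mul_lt hc hε₁).and self_mem_nhdsWithin)))).exists
  rw [one_mul] at h1
  refine ⟨Metric.ball z₀ r, Metric.ball_mem_nhds z₀ hB.r_pos, δ₀, hδ₀, fun η hη => ?_⟩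
  obtain ⟨m₁, δ₁, hδ₁, hm₁⟩ := hB.exists_measure_cutSet_le_mul hphase hmap hcone hnorm htube
    hansatz hδ₀ h1.le h2 h3 hη
  have hfin : ∑' k : ℕ, S.μ (S.tube S.Sminus (b / (a * K) * δ₀ * (κ⁻¹) ^ k)) ≠ ∞ := by
    have hle := hsum (b / (a * K) * δ₀) κ⁻¹ (mul_pos hc hδ₀) h4
      (inv_pos.2 (one_pos.trans hB.one_lt)) (inv_lt_one_of_one_lt₀ hB.one_lt)
    simp only [inter_univ] at hle
    exact ne_top_of_le_ne_top (ENNReal.mul_ne_top (ENNReal.add_ne_top.2 ⟨htube.finite.ne,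
      ENNReal.ofReal_ne_top⟩) ENNReal.ofReal_ne_top) hle
  -- For `δ₁ ≤ δ ≤ δ₀` the cut set grows with `δ`, so it is enough to bound it at `δ₀` by the least
  -- value `η * δ₁` of the right-hand side.
  obtain ⟨m₂, hm₂⟩ := hB.exists_measure_cutSet_le hphase hmap hcone hnorm h1.le h2 h3 hfin
    (ENNReal.ofReal_pos.2 (mul_pos hη hδ₁))
  refine ⟨max m₁ m₂, fun δ hδ hδle => ?_⟩
  change S.μ (S.cutSet _ _ _) ≤ _
  rcases le_total δ δ₁ with h | h
  · exact (measure_mono (SingularSystem.cutSet_subset _ (le_max_left _ _) le_rfl)).trans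
      (hm₁ δ hδ h)
  · exact (measure_mono (SingularSystem.cutSet_subset _ (le_max_right _ _) hδle)).trans
      (hm₂.trans (ENNReal.ofReal_le_ofReal (by gcongr)))
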